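/- Notation. Let $(a)_n=a(a+1)\cdots(a+n-1)$, $(a)_0=1$, let $C_n^{\kappa}$ be the Gegenbauer polynomials, and for $\alpha\in\mathbb R$ let $$\Lambda=\Lambda(\alpha;x,y)=1+(x^2+y^2)\sinh^2\alpha-2xy\sinh\alpha\cosh\alpha ,$$ which is positive for $x,y\in[-1,1]$. Let $\sigma\in\mathbb C$, let $p,q\ge 2$ be integers and $\lambda,\mu\ge0$ integers. Define $P^{[p,q]}_{\sigma\lambda\mu}(\alpha)$ as follows. For $p,q\ge3$: $$P^{[p,q]}_{\sigma\lambda\mu}(\alpha)=a^{pq}_{\lambda\mu}\int_{-1}^{1}\!\int_{-1}^{1}\Lambda^{\sigma/2}\,C_\mu^{\frac{p-2}{2}}(x)\,C_\lambda^{\frac{q-2}{2}}(y)\,(1-x^2)^{\frac{p-3}{2}}(1-y^2)^{\frac{q-3}{2}}\,dx\,dy .$$ For $p\ge3$, $q=2$ (with $y=\cos\phi$): $$P^{[p,2]}_{\sigma\lambda\mu}(\alpha)=a^{p}_{\mu}\int_{-1}^{1}\!\int_{0}^{2\pi}\Lambda^{\sigma/2}\,C_\mu^{\frac{p-2}{2}}(x)\,e^{-i\lambda\phi}(1-x^2)^{\frac{p-3}{2}}\,d\phi\,dx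 .$$ For $p=2$, $q\ge3$ (with $x=\cos\chi$): $$P^{[2,q]}_{\sigma\lambda\mu}(\alpha)=a^{q}_{\lambda}\int_{-1}^{1}\!\int_{0}^{2\pi}\Lambda^{\sigma/2}\,C_\lambda^{\frac{q-2}{2}}(y)\,e^{-i\mu\chi}(1-y^2)^{\frac{q-3}{2}}\,d\chi\,dy .$$ For $p=q=2$ (with $x=\cos\chi$, $y=\cos\phi$): $$P^{[2,2]}_{\sigma\lambda\mu}(\alpha)=\frac1{4\pi^2}\int_0^{2\pi}\!\int_0^{2\pi}\Lambda^{\sigma/2}e^{-i(\lambda\phi+\mu\chi)}\,d\phi\,d\chi .$$ Here $$a^p_\mu=\Gamma\!\left(\tfrac{p-2}2\right)\sqrt{\frac{2^{p-6}\,\mu!\,(2\mu+p-2)\,\Gamma(\frac p2)}{\pi^{7/2}\,\Gamma(\mu+p-2)\,\Gamma(\frac{p-1}2)}},$$ $$a^{pq}_{\lambda\mu}=\Gamma\!\left(\tfrac{p-2}2\right)\Gamma\!\left(\tfrac{q-2}2\right)\sqrt{\frac{2^{p+q-8}\,\Gamma(\frac p2)\Gamma(\frac q2)}{\pi^3\,\Gamma(\frac{p-1}2)\Gamma(\frac{q-1}2)}}\sqrt{\frac{\lambda!\,\mu!\,(2\mu+p-2)(2\lambda+q-2)}{\Gamma(\lambda+q-2)\,\Gamma(\mu+p-2)}}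 .$$ For integers $r,s\ge0$ and $\nu\in\{0,1\}$ the associated spherical function of $SO_0(p,q)$ is $$\mathbb P^{pq\nu}_{\sigma rs}(\alpha)=P^{[p,q]}_{\sigma,\,\nu+2r,\,\nu+2s}(\alpha).$$ Let $$A_1^{pq}=\frac{2^{3-\frac{p+q}2-\nu}\,(-\sigma/2)_{s+r+\nu}}{\Gamma(2s+\nu+\frac p2)\,\Gamma(2r+\nu+\frac q2)}\sqrt{\frac{\pi\,\Gamma(\frac p2)\Gamma(\frac q2)}{\Gamma(\frac{p-1}2)\Gamma(\frac{q-1}2)}}\sqrt{\frac{\Gamma(2s+\nu+p-1)\,\Gamma(2r+\nu+q-1)}{(2s+\nu)!\,(2r+\nu)!}},$$ $$A_2^{pq}=\sqrt{\rho_p(2s+\nu)\,\rho_q(2r+\nu)},\qquad \rho_n(l)=\frac{l+\frac{n-2}2}{l+n-2}\ \ (n\ge3),\qquad \rho_2(l)=\tfrac12 .$$ Statement. Let $p,q\ge2$, $r,s\ge0$, $\nu\in\{0,1\}$, $\sigma\in\mathbb C$, $\alpha\in\mathbb R$. (i) If $s\ge r$, then $$\mathbb P^{pq\nu}_{\sigma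 rs}(\alpha)=\frac{(2s+\nu)!\,\left(\frac{2-\sigma-q}{2}\right)_{s-r}}{(s-r)!\,4^s\,\left(2r+\nu+\frac q2\right)_{s-r}}\,A_1^{pq}A_2^{pq}\,\frac{(\tanh\alpha)^{2s+\nu}}{\cosh\alpha}\;F ,$$ where $F$ is the absolutely convergent Horn series ${}_5F_3$ in the variables $(\tanh^2\alpha,\tanh^2\alpha)$: $$F=\sum_{m,n\ge0}\frac{(s+1)_{m+n}\left(s+\nu+\frac12\right)_{m+n}\left(s+r+\nu-\frac\sigma2\right)_m\left(\frac{q+\sigma}2\right)_n\left(s-r+\frac{p+\sigma}2\right)_n}{\left(2s+\nu+\frac p2\right)_{m+n}\left(s+r+\nu+\frac q2\right)_{m+n}(1+s-r)_n}\,\frac{(\tanh^2\alpha)^{m+n}}{m!\,n!}.$$ (ii) $\mathbb P^{pq\nu}_{\sigma rs}(\alpha)=\mathbb P^{qp\nu}_{\sigma sr}(\alpha)$. Hence, for $s\le r$, $\mathbb P^{pq\nu}_{\sigma rs}(\alpha)$ is given by the right-hand side of (i) after exchanging $p\leftrightarrow q$ and $r\leftrightarrow s$, and the series so obtained converges absolutely.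 (iii) Let the zonal function $Z_\sigma^{[p,q]}(\alpha)$ ($p\ge2$, $q\ge1$) be the mean value of $\Lambda^{\sigma/2}$ over $S^{p-1}\times S^{q-1}$, $x$ and $y$ being the first coordinates on the two unit spheres. Explicitly, $$Z^{[p,q]}_\sigma(\alpha)=\frac{\Gamma(\frac p2)\Gamma(\frac q2)}{\pi\,\Gamma(\frac{p-1}2)\Gamma(\frac{q-1}2)}\int_{-1}^1\!\int_{-1}^1\Lambda^{\sigma/2}(1-x^2)^{\frac{p-3}2}(1-y^2)^{\frac{q-3}2}\,dx\,dy\qquad(p,q\ge3);$$ if $p=2$ (or $q=2$) the mean over $x$ (or $y$) is $\frac1{2\pi}\int_0^{2\pi}d\chi$ with $x=\cos\chi$ (or $\frac1{2\pi}\int_0^{2\pi}d\phi$ with $y=\cos\phi$); if $q=1$, then $\Lambda^{\sigma/2}$ is replaced by $(\cosh\alpha-x\sinh\alpha)^\sigma$ and only the mean over $x$ is taken. For $p,q\ge2$ one has $Z_\sigma^{[p,q]}(\alpha)=\mathbb P^{pq0}_{\sigma00}(\alpha)$, and for $p\ge2$, $q\ge1$ $$Z_\sigma^{[p,q]}(\alpha)=\frac1{\cosh\alpha}\sum_{m,n\ge0}\frac{(1)_{m+n}\left(\frac12\right)_{m+n}\left(-\frac\sigma2\right)_m\left(\frac{q+\sigma}2\right)_n\left(\frac{p+\sigma}2\right)_n}{\left(\frac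 p2\right)_{m+n}\left(\frac q2\right)_{m+n}(1)_n}\,\frac{(\tanh^2\alpha)^{m+n}}{m!\,n!},$$ the series being absolutely convergent. -/

import Mathlib

noncomputable section

namespace SOpq

/-- The Pochhammer symbol `(a)_n = a (a + 1) ⋯ (a + n - 1)`, with `(a)_0 = 1`. -/
def poch (a : ℂ) (n : ℕ) : ℂ := (ascPochhammer ℂ n).eval a

/-- The general term, at the multi-index `n`, of the generalized hypergeometric Horn series in
`k` variables with numerator parameters `a` (exponent vectors `u`) and denominator parameters `b`
(exponent vectors `v`). -/
def hornTerm {k A B : ℕ} (u : Fin A → Fin k → ℕ) (a : Fin A → ℂ)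
    (v : Fin B → Fin k → ℕ) (b : Fin B → ℂ) (x : Fin k → ℂ) (n : Fin k → ℕ) : ℂ :=
  (∏ i, poch (a i) (∑ j, u i j * n j)) / (∏ i, poch (b i) (∑ j, v i j * n j)) *
    ∏ j, x j ^ n j / ((n j).factorial : ℂ)

/-- The sum of the generalized hypergeometric Horn series. -/
def hornSeries {k A B : ℕ} (u : Fin A → Fin k → ℕ) (a : Fin A → ℂ)
    (v : Fin B → Fin k → ℕ) (b : Fin B → ℂ) (x : Fin k → ℂ) : ℂ :=
  ∑' n : Fin k → ℕ, hornTerm u a v b x n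

/-- Exponent vectors `11, 11, 10, 01, 01` of the five numerator parameters. -/
def u5 : Fin 5 → Fin 2 → ℕ := ![![1, 1], ![1, 1], ![1, 0], ![0, 1], ![0, 1]]

/-- Exponent vectors `11, 11, 01` of the three denominator parameters. -/
def v3 : Fin 3 → Fin 2 → ℕ := ![![1, 1], ![1, 1], ![0, 1]]

/-- Numerator parameters of the `₅F₃` series of the associated functions. -/
def assocNum (p q ν : ℕ) (σ : ℂ) (r s : ℕ) : Fin 5 → ℂ :=
  ![(s : ℂ) + 1, (s : ℂ) + ν + 1 / 2, (s : ℂ) + r + ν - σ / 2,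
    ((q : ℂ) + σ) / 2, (s : ℂ) - r + ((p : ℂ) + σ) / 2]

/-- Denominator parameters of the `₅F₃` series of the associated functions. -/
def assocDen (p q ν r s : ℕ) : Fin 3 → ℂ :=
  ![2 * (s : ℂ) + ν + (p : ℂ) / 2, (s : ℂ) + r + ν + (q : ℂ) / 2, 1 + (s : ℂ) - r]

/-- The point `(tanh² α, tanh² α)`. -/
def tanhSq (α : ℝ) : Fin 2 → ℂ := ![((Real.tanh α ^ 2 : ℝ) : ℂ), ((Real.tanh α ^ 2 : ℝ) : ℂ)]

/-- The Gegenbauer polynomial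
`C_n^κ(x) = ∑_{k ≤ n/2} (-1)^k (κ)_{n-k} / (k! (n-2k)!) (2x)^{n-2k}`. -/
def gegenbauer (n : ℕ) (κ x : ℝ) : ℝ :=
  ∑ k ∈ Finset.range (n / 2 + 1),
    (-1) ^ k * (ascPochhammer ℝ (n - k)).eval κ /
      ((k.factorial : ℝ) * ((n - 2 * k).factorial : ℝ)) * (2 * x) ^ (n - 2 * k)

/-- `Λ(α; x, y) = 1 + (x² + y²) sinh² α - 2 x y sinh α cosh α`; it is positive for
`x, y ∈ [-1, 1]`. -/
def Lam (α x y : ℝ) : ℝ :=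
  1 + (x ^ 2 + y ^ 2) * Real.sinh α ^ 2 - 2 * x * y * Real.sinh α * Real.cosh α

/-- `Λ^{σ/2}`. -/
def LamPow (σ : ℂ) (α x y : ℝ) : ℂ := (Lam α x y : ℂ) ^ (σ / 2)

/-- The Gegenbauer weight `(1 - x²)^{(n-3)/2}`. -/
def weight (n : ℕ) (x : ℝ) : ℝ := (1 - x ^ 2) ^ (((n : ℝ) - 3) / 2)

/-- The normalization multiplier `a_μ^p`, for `p ≥ 3`. -/
def aOne (p mu : ℕ) : ℝ :=
  Real.Gamma (((p : ℝ) - 2) / 2) *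
    √((2 : ℝ) ^ ((p : ℝ) - 6) * (mu.factorial : ℝ) * (2 * (mu : ℝ) + p - 2) *
        Real.Gamma ((p : ℝ) / 2) /
      (Real.pi ^ ((7 : ℝ) / 2) * Real.Gamma ((mu : ℝ) + p - 2) *
        Real.Gamma (((p : ℝ) - 1) / 2)))

/-- The normalization multiplier `a_{λμ}^{pq}`, for `p, q ≥ 3`. -/
def aTwo (p q lam mu : ℕ) : ℝ :=
  Real.Gamma (((p : ℝ) - 2) / 2) * Real.Gamma (((q : ℝ) - 2) / 2) *
    √((2 : ℝ) ^ ((p : ℝ) + q - 8) * Real.Gamma ((p : ℝ) / 2) * Real.Gamma ((q : ℝ) / 2) /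
      (Real.pi ^ 3 * Real.Gamma (((p : ℝ) - 1) / 2) * Real.Gamma (((q : ℝ) - 1) / 2))) *
    √((lam.factorial : ℝ) * (mu.factorial : ℝ) * (2 * (mu : ℝ) + p - 2) *
        (2 * (lam : ℝ) + q - 2) /
      (Real.Gamma ((lam : ℝ) + q - 2) * Real.Gamma ((mu : ℝ) + p - 2)))

/-- `P_{σλμ}^{[p,q]}(α)` for `p, q ≥ 2`, by its integral representations: the variable `x = cos χ`
belongs to `p` and `μ`, the variable `y = cos φ` to `q` and `λ`; a variable that belongs to an
index `2` runs over a full circle, with an exponential in place of the Gegenbauer polynomial. -/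
def assocP (p q : ℕ) (σ : ℂ) (lam mu : ℕ) (α : ℝ) : ℂ :=
  if 3 ≤ p ∧ 3 ≤ q then
    (aTwo p q lam mu : ℂ) * ∫ y in (-1 : ℝ)..1, ∫ x in (-1 : ℝ)..1,
      LamPow σ α x y * (gegenbauer mu (((p : ℝ) - 2) / 2) x : ℂ) *
        (gegenbauer lam (((q : ℝ) - 2) / 2) y : ℂ) * (weight p x : ℂ) * (weight q y : ℂ)
  else if 3 ≤ p then
    (aOne p mu : ℂ) * ∫ x in (-1 : ℝ)..1, ∫ φ in (0 : ℝ)..(2 * Real.pi),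
      LamPow σ α x (Real.cos φ) * (gegenbauer mu (((p : ℝ) - 2) / 2) x : ℂ) *
        Complex.exp (-Complex.I * lam * φ) * (weight p x : ℂ)
  else if 3 ≤ q then
    (aOne q lam : ℂ) * ∫ y in (-1 : ℝ)..1, ∫ χ in (0 : ℝ)..(2 * Real.pi),
      LamPow σ α (Real.cos χ) y * (gegenbauer lam (((q : ℝ) - 2) / 2) y : ℂ) *
        Complex.exp (-Complex.I * mu * χ) * (weight q y : ℂ)
  else
    1 / (4 * (Real.pi : ℂ) ^ 2) *
      ∫ χ in (0 : ℝ)..(2 * Real.pi), ∫ φ in (0 : ℝ)..(2 * Real.pi),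
        LamPow σ α (Real.cos χ) (Real.cos φ) *
          Complex.exp (-Complex.I * ((lam : ℂ) * φ + (mu : ℂ) * χ))

/-- The associated function `ℙ_{σrs}^{pqν}(α) = P_{σλμ}^{[p,q]}(α)`, where `λ = ν + 2r` and
`μ = ν + 2s`. -/
def assocFn (p q ν : ℕ) (σ : ℂ) (r s : ℕ) (α : ℝ) : ℂ :=
  assocP p q σ (ν + 2 * r) (ν + 2 * s) α

/-- The zonal function `Z_σ^{[p,q]}(α)` for `p ≥ 2`, `q ≥ 1`: the mean of `Λ^{σ/2}` over the
product of the unit spheres of `ℝ^p` and `ℝ^q`. For `q = 1` the second sphere is `{±1}` and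
`Λ = (cosh α - x sinh α)²` at `y = 1`; the point `y = -1` gives the same mean. -/
def zonal (p q : ℕ) (σ : ℂ) (α : ℝ) : ℂ :=
  if q = 1 then
    if 3 ≤ p then
      ((Real.Gamma ((p : ℝ) / 2) / (√Real.pi * Real.Gamma (((p : ℝ) - 1) / 2)) : ℝ) : ℂ) *
        ∫ x in (-1 : ℝ)..1,
          ((Real.cosh α - x * Real.sinh α : ℝ) : ℂ) ^ σ * (weight p x : ℂ)
    else
      1 / (2 * (Real.pi : ℂ)) * ∫ χ in (0 : ℝ)..(2 * Real.pi),
        ((Real.cosh α - Real.cos χ * Real.sinh α : ℝ) : ℂ) ^ σ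
  else if 3 ≤ p ∧ 3 ≤ q then
    ((Real.Gamma ((p : ℝ) / 2) * Real.Gamma ((q : ℝ) / 2) /
        (Real.pi * Real.Gamma (((p : ℝ) - 1) / 2) * Real.Gamma (((q : ℝ) - 1) / 2)) : ℝ) : ℂ) *
      ∫ y in (-1 : ℝ)..1, ∫ x in (-1 : ℝ)..1,
        LamPow σ α x y * (weight p x : ℂ) * (weight q y : ℂ)
  else if 3 ≤ p then
    ((Real.Gamma ((p : ℝ) / 2) /
        (2 * Real.pi ^ ((3 : ℝ) / 2) * Real.Gamma (((p : ℝ) - 1) / 2)) : ℝ) : ℂ) *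
      ∫ x in (-1 : ℝ)..1, ∫ φ in (0 : ℝ)..(2 * Real.pi),
        LamPow σ α x (Real.cos φ) * (weight p x : ℂ)
  else if 3 ≤ q then
    ((Real.Gamma ((q : ℝ) / 2) /
        (2 * Real.pi ^ ((3 : ℝ) / 2) * Real.Gamma (((q : ℝ) - 1) / 2)) : ℝ) : ℂ) *
      ∫ y in (-1 : ℝ)..1, ∫ χ in (0 : ℝ)..(2 * Real.pi),
        LamPow σ α (Real.cos χ) y * (weight q y : ℂ)
  else
    1 / (4 * (Real.pi : ℂ) ^ 2) *
      ∫ χ in (0 : ℝ)..(2 * Real.pi), ∫ φ in (0 : ℝ)..(2 * Real.pi),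
        LamPow σ α (Real.cos χ) (Real.cos φ)

/-- The factor `A₁`. -/
def A1 (p q ν : ℕ) (σ : ℂ) (r s : ℕ) : ℂ :=
  poch (-σ / 2) (s + r + ν) *
    (((2 : ℝ) ^ (3 - ((p : ℝ) + q) / 2 - ν) /
        (Real.Gamma (2 * (s : ℝ) + ν + (p : ℝ) / 2) *
          Real.Gamma (2 * (r : ℝ) + ν + (q : ℝ) / 2)) *
      √(Real.pi * Real.Gamma ((p : ℝ) / 2) * Real.Gamma ((q : ℝ) / 2) /
        (Real.Gamma (((p : ℝ) - 1) / 2) * Real.Gamma (((q : ℝ) - 1) / 2))) *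
      √(Real.Gamma (2 * (s : ℝ) + ν + p - 1) * Real.Gamma (2 * (r : ℝ) + ν + q - 1) /
        (((2 * s + ν).factorial : ℝ) * ((2 * r + ν).factorial : ℝ))) : ℝ) : ℂ)

/-- `(l + (n-2)/2) / (l + n - 2)` for `n ≥ 3`; for `n = 2`, where the exponentials `e^{ilφ}` are
the normalized basis functions, the value is `1/2`. -/
def normRatio (n l : ℕ) : ℝ :=
  if n = 2 then 1 / 2 else ((l : ℝ) + ((n : ℝ) - 2) / 2) / ((l : ℝ) + n - 2)

/-- The factor `A₂`. -/
def A2 (p q ν r s : ℕ) : ℝ := √(normRatio p (2 * s + ν) * normRatio q (2 * r + ν))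

/-- The explicit factor in front of `(tanh α)^{2s+ν} / cosh α` and the Horn series, for `r ≤ s`. -/
def prefactor (p q ν : ℕ) (σ : ℂ) (r s : ℕ) : ℂ :=
  ((2 * s + ν).factorial : ℂ) * poch ((2 - σ - q) / 2) (s - r) /
    (((s - r).factorial : ℂ) * 4 ^ s * poch (2 * (r : ℂ) + ν + (q : ℂ) / 2) (s - r)) *
    A1 p q ν σ r s * (A2 p q ν r s : ℂ)

end SOpq

end

open SOpq

/-! Put t = tanh α and β = -σ/2. Since cosh² α = 1/(1 - t²), the function cosh α · Λ^(-β) equals (1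
- t²)^(β - 1/2) ((1 - ut)(1 - vt))^(-β), where u + v = 2xy and uv = x² + y² - 1. For x, y in [-1, 1]
one may take |u|, |v| ≤ 1, so the Taylor series in t is dominated, for each |t| < 1, by a summable
sequence independent of x and y (`exists_bound_mehlerCoeff`).

The Taylor coefficients come from Mehler's formula for ∑ H_n(x) H_n(y) t^n / (2^n n!). Scaling both
arguments by √λ and averaging against λ^(β-1) e^(-λ) / Γ(β) turns Mehler's kernel into the function
above. Formally the average is the functional λ^n ↦ (β)_n, which makes sense for every complex β.
The identity `kernelSeries_eq` is obtained without integrals: both sides satisfy one differential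
equation in t, linking β to β + 1, which has a unique solution with prescribed constant terms.

The gain is that each coefficient is a finite double sum in which x and y are separated. Termwise
integration replaces the powers of x and y by moments against the basis functions, and all these
moments have the single shape `HasMoments`, on spheres of every dimension as well as on the circle
and the two-point sphere. The factorials in the moments cancel those in the Hermite coefficients.
For r ≤ s only the exponents ν + 2s + 2N survive, and `double_sum_eq`, two uses of Chu–Vandermonde
and a regrouping, turns the coefficient into one antidiagonal of the Horn series
(`eq_hornSeries_of_hasSum`).

The exchange of p and q is the symmetry of the coefficients in the two moment sequences. The
constants split into one factor per sphere (`sphereNorm_mul_sphereConst`). -/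

namespace SOpq
open Finset

/-! ### Pochhammer symbols and terminating hypergeometric sums -/

@[simp]
lemma poch_zero (a : ℂ) : poch a 0 = 1 := by simp [poch]

lemma poch_succ (a : ℂ) (n : ℕ) : poch a (n + 1) = poch a n * (a + n) := by
  simp [poch, ascPochhammer_succ_eval]

lemma poch_add (a : ℂ) (m n : ℕ) : poch a (m + n) = poch a m * poch (a + m) n := by
  induction n with
  | zero => simp
  | succ n ih => rw [← add_assoc, poch_succ, ih, poch_succ]; push_cast; ring

lemma poch_succ_left (a : ℂ) (n : ℕ) : poch a (n + 1) = a * poch (a + 1) n := by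
  rw [add_comm n 1, poch_add, poch_succ]; simp

lemma poch_one (n : ℕ) : poch 1 n = n.factorial := by
  simp [poch]

lemma poch_ofReal (a : ℝ) (n : ℕ) : poch (a : ℂ) n = (((ascPochhammer ℝ n).eval a : ℝ) : ℂ) := by
  induction n with
  | zero => simp
  | succ n ih => rw [poch_succ, ih, ascPochhammer_succ_eval]; push_cast; ring

lemma poch_ofReal_ne_zero {a : ℝ} (ha : 0 < a) (n : ℕ) : poch (a : ℂ) n ≠ 0 := by
  rw [poch_ofReal]
  exact_mod_cast (ascPochhammer_pos n a ha).ne'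

lemma factorial_mul_poch (m n : ℕ) :
    (m.factorial : ℂ) * poch ((m : ℂ) + 1) n = ((m + n).factorial : ℂ) := by
  rw [← poch_one, ← poch_one, poch_add, add_comm (m : ℂ)]

/-- Reflection of the Pochhammer symbol. -/
lemma poch_one_sub (a : ℂ) (n : ℕ) : poch (1 - a - n) n = (-1) ^ n * poch a n := by
  induction n with
  | zero => simp
  | succ n ih =>
    rw [poch_succ_left, poch_succ]
    have : (1 - a - ((n + 1 : ℕ) : ℂ) + 1) = 1 - a - n := by push_cast; ring
    rw [this, ih]; push_cast; ring

/-- The Chu–Vandermonde convolution. -/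
lemma poch_vandermonde (x y : ℂ) (n : ℕ) :
    ∑ ij ∈ antidiagonal n, poch x ij.1 / (ij.1.factorial : ℂ) * (poch y ij.2 / (ij.2.factorial : ℂ))
      = poch (x + y) n / (n.factorial : ℂ) := by
  induction n generalizing x y with
  | zero => simp
  | succ n ih =>
    have hne : ((n : ℂ) + 1) ≠ 0 := by exact_mod_cast n.succ_ne_zero
    -- Writing n + 1 = i + j, the factor i shifts x to x + 1 and the factor j shifts y to y + 1;
    -- both resulting convolutions have degree n and parameter sum x + y + 1.
    have key : ((n : ℂ) + 1) * ∑ ij ∈ antidiagonal (n + 1),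
        poch x ij.1 / (ij.1.factorial : ℂ) * (poch y ij.2 / (ij.2.factorial : ℂ)) =
        x * (poch (x + 1 + y) n / (n.factorial : ℂ)) +
        y * (poch (x + (y + 1)) n / (n.factorial : ℂ)) := by
      rw [← ih, ← ih, mul_sum, mul_sum, mul_sum]
      have h1 : ∑ ij ∈ antidiagonal (n + 1), ((n : ℂ) + 1) *
          (poch x ij.1 / (ij.1.factorial : ℂ) * (poch y ij.2 / (ij.2.factorial : ℂ))) =
          ∑ ij ∈ antidiagonal (n + 1), (ij.1 : ℂ) *
          (poch x ij.1 / (ij.1.factorial : ℂ) * (poch y ij.2 / (ij.2.factorial : ℂ))) +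
          ∑ ij ∈ antidiagonal (n + 1), (ij.2 : ℂ) *
          (poch x ij.1 / (ij.1.factorial : ℂ) * (poch y ij.2 / (ij.2.factorial : ℂ))) := by
        rw [← sum_add_distrib]
        refine sum_congr rfl fun ij hij => ?_
        have : ((n : ℂ) + 1) = ij.1 + ij.2 := by
          rw [HasAntidiagonal.mem_antidiagonal] at hij; exact_mod_cast hij.symm
        rw [this]; ring
      rw [h1, Nat.sum_antidiagonal_succ, Nat.sum_antidiagonal_succ']
      simp only [Nat.cast_zero, zero_mul, zero_add]
      congr 1 <;> refine sum_congr rfl fun ij _ => ?_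
      · have : ((ij.1 : ℂ) + 1) ≠ 0 := by exact_mod_cast ij.1.succ_ne_zero
        rw [poch_succ_left, Nat.factorial_succ]; push_cast; field_simp
      · have : ((ij.2 : ℂ) + 1) ≠ 0 := by exact_mod_cast ij.2.succ_ne_zero
        rw [poch_succ_left, Nat.factorial_succ]; push_cast; field_simp
    have e1 : x + 1 + y = x + y + 1 := by ring
    have e2 : x + (y + 1) = x + y + 1 := by ring
    rw [e1, e2, ← add_mul] at key
    rw [poch_succ_left, Nat.factorial_succ]
    apply mul_left_cancel₀ hne
    rw [key]; push_cast; field_simp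

/-- A terminating transformation of hypergeometric sums of type `₃F₂`. -/
lemma poch_three_transform (a c f g : ℂ) (n : ℕ) :
    ∑ ij ∈ antidiagonal n, poch a ij.1 * poch (c + ij.1) ij.2 * poch (g - f) ij.1 * poch f ij.2 /
        ((ij.1.factorial : ℂ) * (ij.2.factorial : ℂ)) =
      ∑ ij ∈ antidiagonal n, poch a ij.1 * poch (c - a) ij.2 * poch f ij.2 *
        poch (g + ij.2) ij.1 / ((ij.1.factorial : ℂ) * (ij.2.factorial : ℂ)) := by
  -- Both sides are partial summations of one triple sum over i + k + l = n: summing (a+i)_k (c-a)_l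
  -- over k + l gives the left side, summing (g-f)_i (f+l)_k over i + k gives the right side.
  calc _ = ∑ ij ∈ antidiagonal n, ∑ kl ∈ antidiagonal ij.2,
        poch a (ij.1 + kl.1) / (kl.1.factorial : ℂ) * (poch (c - a) kl.2 / (kl.2.factorial : ℂ)) *
          (poch (g - f) ij.1 / (ij.1.factorial : ℂ)) * poch f (kl.1 + kl.2) := by
        refine sum_congr rfl fun ij _ => ?_
        have h := poch_vandermonde (a + ij.1) (c - a) ij.2
        have e : a + ij.1 + (c - a) = c + ij.1 := by ring
        have hf : ((ij.2.factorial : ℕ) : ℂ) ≠ 0 := by exact_mod_cast ij.2.factorial_ne_zero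
        rw [e] at h
        have h' : poch a ij.1 * poch (c + ij.1) ij.2 * poch (g - f) ij.1 * poch f ij.2 /
          ((ij.1.factorial : ℂ) * (ij.2.factorial : ℂ)) =
          (poch (c + ij.1) ij.2 / (ij.2.factorial : ℂ)) * (poch a ij.1 *
            (poch (g - f) ij.1 / (ij.1.factorial : ℂ)) * poch f ij.2) := by ring
        rw [h', ← h, sum_mul]
        refine sum_congr rfl fun kl hkl => ?_
        rw [HasAntidiagonal.mem_antidiagonal] at hkl
        rw [poch_add a, hkl]; ring
    _ = ∑ ij ∈ antidiagonal n, ∑ kl ∈ antidiagonal ij.1,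
        poch a (kl.1 + kl.2) / (kl.2.factorial : ℂ) * (poch (c - a) ij.2 / (ij.2.factorial : ℂ)) *
          (poch (g - f) kl.1 / (kl.1.factorial : ℂ)) * poch f (kl.2 + ij.2) := by
        rw [sum_sigma', sum_sigma']
        refine sum_nbij' (fun x => ⟨(x.1.1 + x.2.1, x.2.2), (x.1.1, x.2.1)⟩)
          (fun x => ⟨(x.2.1, x.2.2 + x.1.2), (x.2.2, x.1.2)⟩) ?_ ?_ ?_ ?_ ?_ <;>
        rintro ⟨⟨i, j⟩, ⟨k, l⟩⟩ hx <;>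
        simp only [mem_sigma, HasAntidiagonal.mem_antidiagonal] at hx <;>
        obtain ⟨h1, h2⟩ := hx
        · simp only [mem_sigma, HasAntidiagonal.mem_antidiagonal]
          exact ⟨by omega, trivial⟩
        · simp only [mem_sigma, HasAntidiagonal.mem_antidiagonal]
          exact ⟨by omega, trivial⟩
        · subst h2; rfl
        · subst h2; rfl
        · rfl
    _ = _ := by
        refine sum_congr rfl fun ij _ => ?_
        have h := poch_vandermonde (g - f) (f + ij.2) ij.1
        have e : g - f + (f + ij.2) = g + ij.2 := by ring
        rw [e] at h
        have h' : poch a ij.1 * poch (c - a) ij.2 * poch f ij.2 *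
          poch (g + ij.2) ij.1 / ((ij.1.factorial : ℂ) * (ij.2.factorial : ℂ)) =
          (poch (g + ij.2) ij.1 / (ij.1.factorial : ℂ)) * (poch a ij.1 *
            (poch (c - a) ij.2 / (ij.2.factorial : ℂ)) * poch f ij.2) := by ring
        rw [h', ← h, sum_mul]
        refine sum_congr rfl fun kl hkl => ?_
        rw [HasAntidiagonal.mem_antidiagonal] at hkl
        rw [add_comm kl.2, poch_add f, hkl]; ring

/-- The first i factors, those below e, reflect to (1 - e)_i; the remaining ones are cut after δ
steps. Thus i is left only in lengths, not in parameters. -/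
lemma poch_sub_natCast {N i : ℕ} (hi : i ≤ N) (e : ℂ) (δ : ℕ) :
    poch (e - i) (N + δ) = (-1) ^ i * poch (1 - e) i * poch e δ * poch (e + δ) (N - i) := by
  obtain ⟨k, rfl⟩ := Nat.exists_eq_add_of_le hi
  have h1 : i + k + δ = i + (δ + k) := by ring
  have h2 := poch_one_sub (1 - e) i
  have e2 : 1 - (1 - e) - (i : ℂ) = e - i := by ring
  rw [e2] at h2
  rw [h1, poch_add, poch_add, h2]
  simp only [sub_add_cancel, add_tsub_cancel_left]
  ring

/-- Chu–Vandermonde with second parameter 1 - d - n: reflection turns (1-d-n)_l into (-1)^l (d+j)_l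
= (-1)^l (d)_n / (d)_j. -/
lemma sum_neg_one_pow_poch_div (a d : ℂ) (hd : ∀ n, poch d n ≠ 0) (n : ℕ) :
    ∑ jl ∈ antidiagonal n, (-1) ^ jl.2 * poch a jl.1 /
      ((jl.1.factorial : ℂ) * (jl.2.factorial : ℂ) * poch d jl.1) =
      (-1) ^ n * poch (d - a) n / ((n.factorial : ℂ) * poch d n) := by
  have h := poch_vandermonde a (1 - d - n) n
  have e : a + (1 - d - n) = 1 - (d - a) - n := by ring
  rw [e, poch_one_sub] at h
  rw [mul_comm (n.factorial : ℂ), div_mul_eq_div_div_swap, ← h, sum_div]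
  refine sum_congr rfl fun jl hjl => ?_
  rw [HasAntidiagonal.mem_antidiagonal] at hjl
  have h1 := poch_one_sub (d + jl.1) jl.2
  have e1 : 1 - (d + jl.1) - (jl.2 : ℂ) = 1 - d - n := by rw [← hjl]; push_cast; ring
  have h2 : poch d n = poch d jl.1 * poch (d + jl.1) jl.2 := by rw [← poch_add, hjl]
  rw [← e1, h1, h2]
  have h3 : poch (d + jl.1) jl.2 ≠ 0 := fun h0 => hd n (by rw [h2, h0, mul_zero])
  have := hd jl.1
  field_simp

/-- Reduction of a terminating double hypergeometric sum to a single one. -/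
lemma double_sum_eq (a c d : ℂ) (hc : ∀ n, poch c n ≠ 0) (hd : ∀ n, poch d n ≠ 0) (N δ : ℕ) :
    ∑ ik ∈ antidiagonal N, ∑ jl ∈ antidiagonal (N + δ), (-1) ^ (ik.2 + jl.2) *
      poch a (ik.1 + jl.1) / ((ik.1.factorial : ℂ) * (ik.2.factorial : ℂ) * poch c ik.1 *
        ((jl.1.factorial : ℂ) * (jl.2.factorial : ℂ) * poch d jl.1)) =
    (-1) ^ δ * poch (d - a) δ / ((δ.factorial : ℂ) * poch d (N + δ) * poch c N) *
      ∑ mn ∈ antidiagonal N, poch a mn.1 * poch (c - a) mn.2 * poch (d - a + δ) mn.2 /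
        ((mn.1.factorial : ℂ) * (mn.2.factorial : ℂ) * poch (1 + δ) mn.2) := by
  have hfac : ∀ n : ℕ, (n.factorial : ℂ) ≠ 0 := fun n => by exact_mod_cast n.factorial_ne_zero
  -- The inner sum is a `₂F₁` at 1. Its value is split so that its dependence on i is that of the
  -- left side of `poch_three_transform` with f = d - a + δ and g = 1 + δ.
  have h1 : ∀ ik ∈ antidiagonal N, ∑ jl ∈ antidiagonal (N + δ), (-1) ^ (ik.2 + jl.2) *
      poch a (ik.1 + jl.1) / ((ik.1.factorial : ℂ) * (ik.2.factorial : ℂ) * poch c ik.1 *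
        ((jl.1.factorial : ℂ) * (jl.2.factorial : ℂ) * poch d jl.1)) =
      (-1) ^ δ * poch (d - a) δ / (((N + δ).factorial : ℂ) * poch d (N + δ) * poch c N) *
      (poch a ik.1 * poch (c + ik.1) ik.2 * poch ((1 + δ) - (d - a + δ)) ik.1 *
        poch (d - a + δ) ik.2 / ((ik.1.factorial : ℂ) * (ik.2.factorial : ℂ))) := by
    intro ik hik
    rw [HasAntidiagonal.mem_antidiagonal] at hik
    have h := sum_neg_one_pow_poch_div (a + ik.1) d hd (N + δ)
    have e1 : d - (a + ik.1) = d - a - ik.1 := by ring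
    have e2 : (1 + δ : ℂ) - (d - a + δ) = 1 - (d - a) := by ring
    have e3 : N - ik.1 = ik.2 := by omega
    rw [e1, poch_sub_natCast (by omega), e3] at h
    have h2 : poch c N = poch c ik.1 * poch (c + ik.1) ik.2 := by rw [← poch_add, hik]
    have h3 : poch (c + ik.1) ik.2 ≠ 0 := fun h0 => hc N (by rw [h2, h0, mul_zero])
    have h4 : ∑ jl ∈ antidiagonal (N + δ), (-1) ^ (ik.2 + jl.2) *
      poch a (ik.1 + jl.1) / ((ik.1.factorial : ℂ) * (ik.2.factorial : ℂ) * poch c ik.1 *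
        ((jl.1.factorial : ℂ) * (jl.2.factorial : ℂ) * poch d jl.1)) =
      (-1) ^ ik.2 * poch a ik.1 / ((ik.1.factorial : ℂ) * (ik.2.factorial : ℂ) * poch c ik.1) *
      ∑ jl ∈ antidiagonal (N + δ), (-1) ^ jl.2 * poch (a + ik.1) jl.1 /
      ((jl.1.factorial : ℂ) * (jl.2.factorial : ℂ) * poch d jl.1) := by
      rw [mul_sum]
      refine sum_congr rfl fun jl _ => ?_
      rw [poch_add a, pow_add, div_mul_div_comm]
      ring
    rw [h4, h, h2, e2]
    have s1 : ((-1 : ℂ)) ^ ik.2 * (-1) ^ (N + δ) * (-1) ^ ik.1 = (-1) ^ δ := by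
      rw [← pow_add, ← pow_add]
      have : ik.2 + (N + δ) + ik.1 = δ + 2 * N := by omega
      rw [this, pow_add, pow_mul]; simp
    rw [← s1]
    have := hc ik.1
    have := hd (N + δ)
    field_simp
  rw [sum_congr rfl h1, ← mul_sum, poch_three_transform, mul_sum, mul_sum]
  refine sum_congr rfl fun mn hmn => ?_
  rw [HasAntidiagonal.mem_antidiagonal] at hmn
  -- The factor (g + n)_m of the transformed sum is a piece of (N + δ)!; dividing it out leaves δ!
  -- and the denominator (1 + δ)_n.
  have h2 : (((N + δ).factorial : ℕ) : ℂ) =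
      (δ.factorial : ℂ) * (poch (1 + δ) mn.2 * poch (1 + δ + mn.2) mn.1) := by
    rw [← poch_add, add_comm mn.2, hmn, add_comm N, ← factorial_mul_poch, add_comm (δ : ℂ)]
  have h3 : poch (1 + δ) mn.2 ≠ 0 := fun h0 => hfac (N + δ) (by rw [h2, h0]; simp)
  have h4 : poch (1 + δ + mn.2) mn.1 ≠ 0 := fun h0 => hfac (N + δ) (by rw [h2, h0]; simp)
  rw [h2]
  have := hc N
  have := hd (N + δ)
  field_simp

end SOpq

/-! ### The kernel as a formal power series and its differential equation -/

namespace SOpq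
open Finset PowerSeries

noncomputable section

/-- The power series `∑ (c)_n / n! w^n X^n` of `(1 - w X)^{-c}`. -/
def binSeries (c w : ℂ) : PowerSeries ℂ := .mk fun n => poch c n / (n.factorial : ℂ) * w ^ n

lemma coeff_binSeries (c w : ℂ) (n : ℕ) :
    coeff n (binSeries c w) = poch c n / (n.factorial : ℂ) * w ^ n := by
  simp [binSeries]

lemma one_sub_mul_binSeries (c w : ℂ) :
    (1 - C w * X) * binSeries (c + 1) w = binSeries c w := by
  ext n
  have e : (1 - C w * X) * binSeries (c + 1) w =
    binSeries (c + 1) w - C w * (X * binSeries (c + 1) w) := by ring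
  rw [e, map_sub, coeff_C_mul]
  cases n with
  | zero => simp [coeff_binSeries]
  | succ n =>
    rw [coeff_succ_X_mul, coeff_binSeries, coeff_binSeries, coeff_binSeries, poch_succ,
      poch_succ_left, Nat.factorial_succ]
    have : ((n : ℂ) + 1) ≠ 0 := by exact_mod_cast n.succ_ne_zero
    have : (n.factorial : ℂ) ≠ 0 := by exact_mod_cast n.factorial_ne_zero
    push_cast
    field_simp
    ring

lemma derivative_binSeries (c w : ℂ) :
    d⁄dX ℂ (binSeries c w) = C (c * w) * binSeries (c + 1) w := by
  ext n
  rw [coeff_derivative, coeff_C_mul, coeff_binSeries, coeff_binSeries, poch_succ_left,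
    Nat.factorial_succ]
  have : ((n : ℂ) + 1) ≠ 0 := by exact_mod_cast n.succ_ne_zero
  push_cast
  field_simp
  ring

/-- The power series of `(1 - X²)^{β - 1/2} ((1 - u X) (1 - v X))^{-β}`. -/
def kernelSeries (u v β : ℂ) : PowerSeries ℂ :=
  binSeries (1 / 2 - β) 1 * binSeries (1 / 2 - β) (-1) * binSeries β u * binSeries β v

/-- The differential equation that characterizes the family `kernelSeries u v`. -/
def KernelEq (S R : ℂ) (G : ℂ → PowerSeries ℂ) : Prop :=
  ∀ β, (1 - X ^ 2) ^ 2 * d⁄dX ℂ (G β) = X * (1 - X ^ 2) * G β +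
    C β * (C S * (1 + X ^ 2) - C R * X) * G (β + 1)

/-- With Q = (1 - uX)(1 - vX), logarithmic differentiation gives -2XQ - (1 - X²)Q' as the
coefficient of β; it collapses to S(1 + X²) - RX. The division by Q is absorbed by passing from β to
β + 1. -/
lemma kernelEq_kernelSeries (u v : ℂ) :
    KernelEq (u + v) (2 * (u * v + 1)) (kernelSeries u v) := by
  intro β
  have e1 : (1 / 2 - β : ℂ) + 1 = 3 / 2 - β := by ring
  have e2 : (1 / 2 - (β + 1) : ℂ) + 1 = 1 / 2 - β := by ring
  have a1 := one_sub_mul_binSeries (1 / 2 - β) 1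
  have a2 := one_sub_mul_binSeries (1 / 2 - β) (-1)
  have b1 := one_sub_mul_binSeries (1 / 2 - (β + 1)) 1
  have b2 := one_sub_mul_binSeries (1 / 2 - (β + 1)) (-1)
  have a3 := one_sub_mul_binSeries β u
  have a4 := one_sub_mul_binSeries β v
  rw [e1] at a1 a2
  rw [e2, ← a1] at b1
  rw [e2, ← a2] at b2
  simp only [kernelSeries, Derivation.leibniz, derivative_binSeries, e1, smul_eq_mul]
  -- All series become polynomial multiples of the four with parameters 3/2 - β (twice) and β + 1
  -- (twice), so only a polynomial identity remains.
  rw [← b1, ← b2, ← a1, ← a2, ← a3, ← a4]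
  simp only [map_sub, map_mul, map_add, map_one, map_neg, map_ofNat]
  have h2 : (2 : PowerSeries ℂ) * C (1 / 2 : ℂ) = 1 := by
    rw [← map_ofNat (C (R := ℂ)), ← map_mul]; simp
  generalize C (1 / 2 : ℂ) = q at *
  generalize binSeries (3 / 2 - β) 1 = p1
  generalize binSeries (3 / 2 - β) (-1) = p2
  generalize binSeries (β + 1) u = U
  generalize binSeries (β + 1) v = V
  generalize C u = u
  generalize C v = v
  generalize C β = β
  linear_combination (exp := 1) (X * (1 - X ^ 2) ^ 2 * (1 - u * X) * (1 - v * X) * p1 * p2 * U * V) * h2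

/-- The equation determines the derivative at β to the order to which the series at β and β + 1 are
known, and integration gains one order. The induction on the order must therefore run over all β at
once. -/
lemma KernelEq.unique {S R : ℂ} {G H : ℂ → PowerSeries ℂ} (hG : KernelEq S R G)
    (hH : KernelEq S R H) (h0 : ∀ β, constantCoeff (G β) = constantCoeff (H β)) (β : ℂ) :
    G β = H β := by
  have key : ∀ n : ℕ, ∀ β, X ^ (n + 1) ∣ G β - H β := by
    intro n
    induction n with
    | zero =>
      intro β
      simp [X_dvd_iff, h0]
    | succ n ih =>
      intro β
      -- From (1 - X²)² = 1 - X²(2 - X²): the derivative left on the right carries a power of X,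
      -- which makes up for the order lost by differentiating.
      have hd : d⁄dX ℂ (G β - H β) = X * (X * (2 - X ^ 2) * d⁄dX ℂ (G β - H β)) +
          X * (1 - X ^ 2) * (G β - H β) +
          C β * (C S * (1 + X ^ 2) - C R * X) * (G (β + 1) - H (β + 1)) := by
        have h1 := hG β
        have h2 := hH β
        rw [map_sub]
        linear_combination h1 - h2
      have hD : X ^ n ∣ d⁄dX ℂ (G β - H β) := by
        rw [X_pow_dvd_iff]
        intro m hm
        rw [coeff_derivative, (X_pow_dvd_iff.mp (ih β)) (m + 1) (by omega), zero_mul]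
      have hD' : X ^ (n + 1) ∣ d⁄dX ℂ (G β - H β) := by
        rw [hd]
        refine dvd_add (dvd_add ?_ ((ih β).mul_left _)) ((ih (β + 1)).mul_left _)
        rw [pow_succ']
        exact mul_dvd_mul_left _ (hD.mul_left _)
      rw [X_pow_dvd_iff]
      intro m hm
      rcases m with _ | m
      · exact X_pow_dvd_iff.mp (ih β) 0 (by omega)
      · have := X_pow_dvd_iff.mp hD' m (by omega)
        rw [coeff_derivative] at this
        exact (mul_eq_zero.mp this).resolve_right (by exact_mod_cast m.succ_ne_zero)
  rw [← sub_eq_zero]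
  ext n
  simpa using X_pow_dvd_iff.mp (key n β) n (by omega)

/-! ### Hermite polynomials and their products -/

/-- Recurrences of polynomials of the form `∑ g n k z^{n-2k}`. -/
lemma half_sum_recurrence {R : Type*} [CommRing R] (g : ℕ → ℕ → R) (z : R) (n : ℕ) (A B D : R)
    (h0 : A * g (n + 2) 0 = B * g (n + 1) 0)
    (h1 : ∀ k, 2 * k + 1 ≤ n → A * g (n + 2) (k + 1) = B * g (n + 1) (k + 1) - D * g n k)
    (h2 : ∀ k, n = 2 * k → A * g (n + 2) (k + 1) = - (D * g n k)) :
    A * ∑ k ∈ range ((n + 2) / 2 + 1), g (n + 2) k * z ^ (n + 2 - 2 * k) =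
      B * z * ∑ k ∈ range ((n + 1) / 2 + 1), g (n + 1) k * z ^ (n + 1 - 2 * k) -
      D * ∑ k ∈ range (n / 2 + 1), g n k * z ^ (n - 2 * k) := by
  have ext : ∀ m N : ℕ, m / 2 < N → ∑ k ∈ range (m / 2 + 1), g m k * z ^ (m - 2 * k) =
      ∑ k ∈ range N, if 2 * k ≤ m then g m k * z ^ (m - 2 * k) else 0 := by
    intro m N hN
    rw [← sum_filter]
    refine sum_congr ?_ fun _ _ => rfl
    ext k
    simp only [mem_range, mem_filter]
    omega
  -- Zero-extension to longer ranges lets the terms k + 1 of degrees n + 2 and n + 1 meet the term k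
  -- of degree n; the terms k = 0 are split off and settled by `h0`.
  rw [ext (n + 2) (n + 3) (by omega), ext (n + 1) (n + 3) (by omega), ext n (n + 2) (by omega),
    sum_range_succ', sum_range_succ' (n := n + 2), mul_add, mul_add, mul_sum, mul_sum, mul_sum,
    add_sub_right_comm, ← sum_sub_distrib]
  congr 1
  · refine sum_congr rfl fun k _ => ?_
    rcases lt_trichotomy n (2 * k) with h | h | h
    · rw [if_neg (by omega), if_neg (by omega), if_neg (by omega)]; simp
    · rw [if_pos (by omega), if_neg (by omega), if_pos (by omega), ← mul_assoc, h2 k h]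
      have : n + 2 - 2 * (k + 1) = n - 2 * k := by omega
      rw [this]; ring
    · rw [if_pos (by omega), if_pos (by omega), if_pos (by omega), ← mul_assoc, h1 k h]
      have e1 : n + 2 - 2 * (k + 1) = n + 1 - 2 * (k + 1) + 1 := by omega
      have e2 : n - 2 * k = n + 1 - 2 * (k + 1) + 1 := by omega
      rw [e1, e2, pow_succ]; ring
  · simp only [mul_zero, zero_le, if_true, tsub_zero]
    rw [← mul_assoc, h0, pow_succ]; ring

/-- Coefficients of the Hermite polynomials divided by `n!`. -/
def hermCoeff (n k : ℕ) : ℂ := (-1) ^ k / ((k.factorial : ℂ) * ((n - 2 * k).factorial : ℂ))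

/-- The physicists' Hermite polynomials divided by `n!`. -/
def herm (n : ℕ) (z : ℂ) : ℂ := ∑ k ∈ range (n / 2 + 1), hermCoeff n k * (2 * z) ^ (n - 2 * k)

lemma herm_recurrence (n : ℕ) (z : ℂ) :
    ((n : ℂ) + 2) * herm (n + 2) z = 2 * z * herm (n + 1) z - 2 * herm n z := by
  have hf : ∀ m : ℕ, (m.factorial : ℂ) ≠ 0 := fun m => by exact_mod_cast m.factorial_ne_zero
  have h := half_sum_recurrence hermCoeff (2 * z) n ((n : ℂ) + 2) 1 2 ?_ ?_ ?_
  · simpa [herm] using h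
  · have h1 := hf (n + 1)
    have h2 : ((n : ℂ) + 2) ≠ 0 := by exact_mod_cast (n + 1).succ_ne_zero
    simp only [hermCoeff, mul_zero, tsub_zero, Nat.factorial_succ (n + 1)]
    push_cast
    rw [show (n : ℂ) + 1 + 1 = n + 2 by ring]
    field_simp
  · intro k hk
    obtain ⟨m, rfl⟩ := Nat.exists_eq_add_of_le hk
    have e1 : 2 * k + 1 + m + 2 - 2 * (k + 1) = m + 1 := by omega
    have e2 : 2 * k + 1 + m + 1 - 2 * (k + 1) = m := by omega
    have e3 : 2 * k + 1 + m - 2 * k = m + 1 := by omega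
    have h1 := hf m
    have h2 := hf k
    have h3 : ((k : ℂ) + 1) ≠ 0 := by exact_mod_cast k.succ_ne_zero
    have h4 : ((m : ℂ) + 1) ≠ 0 := by exact_mod_cast m.succ_ne_zero
    simp only [hermCoeff, e1, e2, e3, Nat.factorial_succ]
    push_cast
    field_simp
    ring
  · intro k hk
    subst hk
    have h2 := hf k
    have h3 : ((k : ℂ) + 1) ≠ 0 := by exact_mod_cast k.succ_ne_zero
    have e1 : 2 * k + 2 - 2 * (k + 1) = 0 := by omega
    simp only [hermCoeff, e1, Nat.factorial_succ, Nat.sub_self]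
    push_cast
    field_simp
    ring

/-- `H_n(u) H_n(v) / (2^n n!)`. -/
def hermProd (u v : ℂ) (n : ℕ) : ℂ := (n.factorial : ℂ) / 2 ^ n * (herm n u * herm n v)

lemma herm_zero (z : ℂ) : herm 0 z = 1 := by simp [herm, hermCoeff]
lemma herm_one (z : ℂ) : herm 1 z = 2 * z := by simp [herm, hermCoeff]
lemma herm_two (z : ℂ) : herm 2 z = 2 * z ^ 2 - 1 := by
  have h := herm_recurrence 0 z
  simp only [Nat.cast_zero, zero_add, herm_one, herm_zero] at h
  linear_combination h / 2
lemma herm_three (z : ℂ) : herm 3 z = (4 * z ^ 3 - 6 * z) / 3 := by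
  have h := herm_recurrence 1 z
  simp only [Nat.cast_one, Nat.reduceAdd, herm_one, herm_two] at h
  linear_combination h / 3

/-- This is the differential equation of Mehler's kernel in t, read on coefficients. The right-hand
coefficients are homogeneous of degree 2 in u and v, so the scaling u = zx, v = zy puts a factor z²
there and nowhere else. -/
lemma hermProd_recurrence (u v : ℂ) (n : ℕ) :
    ((n : ℂ) + 4) * hermProd u v (n + 4) - (2 * n + 5) * hermProd u v (n + 2) +
      (n + 1) * hermProd u v n =
    2 * u * v * (hermProd u v (n + 3) + hermProd u v (n + 1)) -
      2 * (u ^ 2 + v ^ 2) * hermProd u v (n + 2) := by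
  have k2 : ((n : ℂ) + 2) ≠ 0 := by exact_mod_cast (n + 1).succ_ne_zero
  have k3 : ((n : ℂ) + 3) ≠ 0 := by exact_mod_cast (n + 2).succ_ne_zero
  have k4 : ((n : ℂ) + 4) ≠ 0 := by exact_mod_cast (n + 3).succ_ne_zero
  have key : ∀ z, herm (n + 2) z = (2 * z * herm (n + 1) z - 2 * herm n z) / (n + 2) ∧
      herm (n + 3) z = (2 * z * herm (n + 2) z - 2 * herm (n + 1) z) / (n + 3) ∧
      herm (n + 4) z = (2 * z * herm (n + 3) z - 2 * herm (n + 2) z) / (n + 4) := by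
    intro z
    have h1 := herm_recurrence n z
    have h2 := herm_recurrence (n + 1) z
    have h3 := herm_recurrence (n + 2) z
    push_cast at h2 h3
    refine ⟨?_, ?_, ?_⟩ <;> rw [eq_div_iff (by assumption)]
    · linear_combination h1
    · linear_combination h2
    · linear_combination h3
  obtain ⟨u2, u3, u4⟩ := key u
  obtain ⟨v2, v3, v4⟩ := key v
  simp only [hermProd, Nat.factorial_succ, pow_succ]
  rw [u4, v4, u3, v3, u2, v2]
  push_cast
  rw [show (n : ℂ) + 3 + 1 = n + 4 by ring, show (n : ℂ) + 2 + 1 = n + 3 by ring,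
    show (n : ℂ) + 1 + 1 = n + 2 by ring]
  have h2 : (2 : ℂ) ^ n ≠ 0 := pow_ne_zero _ two_ne_zero
  field_simp
  ring

end

end SOpq

/-! ### Mehler's formula averaged over the scale of the arguments -/

namespace SOpq
open Finset

noncomputable section

/-- The polynomial in `λ` whose value is `H_n(√λ x) H_n(√λ y) / (2^n n!)`. -/
def mehlerPoly (x y : ℂ) (n : ℕ) : Polynomial ℂ :=
  Polynomial.C ((n.factorial : ℂ) / 2 ^ n) *
    ∑ a ∈ range (n / 2 + 1), ∑ b ∈ range (n / 2 + 1),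
      Polynomial.C (hermCoeff n a * (2 * x) ^ (n - 2 * a) *
        (hermCoeff n b * (2 * y) ^ (n - 2 * b))) * Polynomial.X ^ (n - a - b)

lemma eval_mehlerPoly (x y z : ℂ) (n : ℕ) :
    (mehlerPoly x y n).eval (z ^ 2) = hermProd (z * x) (z * y) n := by
  simp only [mehlerPoly, hermProd, herm, Polynomial.eval_mul, Polynomial.eval_C,
    Polynomial.eval_finsetSum, Polynomial.eval_pow, Polynomial.eval_X, sum_mul_sum]
  congr 1
  refine sum_congr rfl fun a ha => sum_congr rfl fun b hb => ?_
  rw [mem_range] at ha hb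
  have e : (z ^ 2) ^ (n - a - b) = z ^ (n - 2 * a) * z ^ (n - 2 * b) := by
    rw [← pow_mul, ← pow_add]; congr 1; omega
  rw [e, show 2 * (z * x) = z * (2 * x) by ring, show 2 * (z * y) = z * (2 * y) by ring,
    mul_pow z, mul_pow z]
  ring

/-- Every complex number is a square, so identities in λ may be tested at λ = z², where √λ is the
polynomial quantity z. -/
lemma polynomial_ext_sq {P Q : Polynomial ℂ} (h : ∀ z : ℂ, P.eval (z ^ 2) = Q.eval (z ^ 2)) :
    P = Q := by
  refine Polynomial.funext fun w => ?_
  obtain ⟨z, hz⟩ := IsAlgClosed.exists_pow_nat_eq w (n := 2) (by norm_num)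
  rw [← hz, h]

open Polynomial in
lemma mehlerPoly_recurrence (x y : ℂ) (n : ℕ) :
    C ((n : ℂ) + 4) * mehlerPoly x y (n + 4) - C (2 * (n : ℂ) + 5) * mehlerPoly x y (n + 2) +
      C ((n : ℂ) + 1) * mehlerPoly x y n =
    X * (C (2 * x * y) * (mehlerPoly x y (n + 3) + mehlerPoly x y (n + 1)) -
      C (2 * (x ^ 2 + y ^ 2)) * mehlerPoly x y (n + 2)) := by
  refine polynomial_ext_sq fun z => ?_
  simp only [eval_sub, eval_add, eval_mul, eval_C, eval_X, eval_mehlerPoly]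
  linear_combination hermProd_recurrence (z * x) (z * y) n

open Polynomial in
lemma mehlerPoly_zero (x y : ℂ) : mehlerPoly x y 0 = 1 := by
  simp [mehlerPoly, hermCoeff]

-- This relation and the next two are the low-degree cases of the recurrence, in which the terms of
-- negative index are absent.
open Polynomial in
lemma mehlerPoly_one (x y : ℂ) : mehlerPoly x y 1 = X * (C (2 * x * y) * mehlerPoly x y 0) := by
  refine polynomial_ext_sq fun z => ?_
  simp only [eval_mul, eval_C, eval_X, eval_mehlerPoly, hermProd, herm_one, herm_zero]
  simp
  ring

open Polynomial in
lemma mehlerPoly_two (x y : ℂ) : C 2 * mehlerPoly x y 2 - mehlerPoly x y 0 =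
    X * (C (2 * x * y) * mehlerPoly x y 1 - C (2 * (x ^ 2 + y ^ 2)) * mehlerPoly x y 0) := by
  refine polynomial_ext_sq fun z => ?_
  simp only [eval_sub, eval_mul, eval_C, eval_X, eval_mehlerPoly, hermProd, herm_one, herm_zero,
    herm_two, Nat.factorial]
  norm_num
  ring

open Polynomial in
lemma mehlerPoly_three (x y : ℂ) : C 3 * mehlerPoly x y 3 - C 3 * mehlerPoly x y 1 =
    X * (C (2 * x * y) * (mehlerPoly x y 2 + mehlerPoly x y 0) -
      C (2 * (x ^ 2 + y ^ 2)) * mehlerPoly x y 1) := by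
  refine polynomial_ext_sq fun z => ?_
  simp only [eval_sub, eval_add, eval_mul, eval_C, eval_X, eval_mehlerPoly, hermProd, herm_one,
    herm_zero, herm_two, herm_three, Nat.factorial]
  norm_num
  ring

/-- The linear functional on polynomials with `X ^ n ↦ (β)_n`. -/
def gammaFunctional (β : ℂ) : Polynomial ℂ →ₗ[ℂ] ℂ :=
  Polynomial.lsum fun n => (poch β n) • (LinearMap.id : ℂ →ₗ[ℂ] ℂ)

lemma gammaFunctional_C_mul_X_pow (β c : ℂ) (n : ℕ) :
    gammaFunctional β (Polynomial.C c * Polynomial.X ^ n) = c * poch β n := by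
  rw [Polynomial.C_mul_X_pow_eq_monomial, gammaFunctional, Polynomial.lsum_apply,
    Polynomial.sum_monomial_index] <;> simp [mul_comm]

lemma gammaFunctional_C_mul (β c : ℂ) (P : Polynomial ℂ) :
    gammaFunctional β (Polynomial.C c * P) = c * gammaFunctional β P := by
  rw [← Polynomial.smul_eq_C_mul, map_smul, smul_eq_mul]

/-- From (β)_(n+1) = β (β+1)_n: the formal version of λ · λ^(β-1)/Γ(β) = β · λ^β/Γ(β+1). -/
lemma gammaFunctional_X_mul (β : ℂ) (P : Polynomial ℂ) :
    gammaFunctional β (Polynomial.X * P) = β * gammaFunctional (β + 1) P := by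
  induction P using Polynomial.induction_on' with
  | add p q hp hq => rw [mul_add, map_add, hp, hq, map_add, mul_add]
  | monomial n a =>
    rw [← Polynomial.C_mul_X_pow_eq_monomial, gammaFunctional_C_mul_X_pow,
      show (Polynomial.X : Polynomial ℂ) * (Polynomial.C a * Polynomial.X ^ n) =
        Polynomial.C a * Polynomial.X ^ (n + 1) by ring, gammaFunctional_C_mul_X_pow,
      poch_succ_left]
    ring

/-- The `n`-th Taylor coefficient in `tanh α` of `cosh α · Λ^{-β}`. -/
def mehlerCoeff (β x y : ℂ) (n : ℕ) : ℂ := gammaFunctional β (mehlerPoly x y n)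

lemma mehlerCoeff_eq (β x y : ℂ) (n : ℕ) :
    mehlerCoeff β x y n = (n.factorial : ℂ) / 2 ^ n *
      ∑ a ∈ range (n / 2 + 1), ∑ b ∈ range (n / 2 + 1),
        (hermCoeff n a * (2 * x) ^ (n - 2 * a) * (hermCoeff n b * (2 * y) ^ (n - 2 * b))) *
          poch β (n - a - b) := by
  simp only [mehlerCoeff, mehlerPoly]
  rw [gammaFunctional_C_mul]
  simp only [map_sum, gammaFunctional_C_mul_X_pow]

-- Coefficientwise, the equation is the image of the recurrence of `mehlerPoly` under the
-- functional; the factor X on the right of the recurrence produces β and the shift to β + 1.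
open PowerSeries in
lemma kernelEq_mehlerCoeff (x y : ℂ) :
    KernelEq (2 * x * y) (2 * (x ^ 2 + y ^ 2)) fun β => .mk (mehlerCoeff β x y) := by
  intro β
  have hX : ∀ P, gammaFunctional β (Polynomial.X * P) = β * gammaFunctional (β + 1) P :=
    gammaFunctional_X_mul β
  have e1 : ∀ G : PowerSeries ℂ, (1 - X ^ 2) ^ 2 * G = G - C 2 * (X ^ 2 * G) + X ^ 4 * G := by
    intro G; rw [map_ofNat]; ring
  have e2 : ∀ G : PowerSeries ℂ, X * (1 - X ^ 2) * G = X ^ 1 * G - X ^ 3 * G := by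
    intro G; ring
  have e3 : ∀ G : PowerSeries ℂ, C β * (C (2 * x * y) * (1 + X ^ 2) -
      C (2 * (x ^ 2 + y ^ 2)) * X) * G = C β * (C (2 * x * y) * (G + X ^ 2 * G) -
        C (2 * (x ^ 2 + y ^ 2)) * (X ^ 1 * G)) := by
    intro G; ring
  ext n
  rw [e1, e2, e3]
  simp only [map_add, map_sub, coeff_C_mul, coeff_X_pow_mul', coeff_derivative, coeff_mk]
  rcases n with _ | _ | _ | n
  · have h := congrArg (gammaFunctional β) (mehlerPoly_one x y)
    rw [hX, gammaFunctional_C_mul] at h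
    simp only [mehlerCoeff]
    norm_num
    linear_combination h
  · have h := congrArg (gammaFunctional β) (mehlerPoly_two x y)
    simp only [hX, gammaFunctional_C_mul, map_sub] at h
    simp only [mehlerCoeff]
    norm_num
    linear_combination h
  · have h := congrArg (gammaFunctional β) (mehlerPoly_three x y)
    simp only [hX, gammaFunctional_C_mul, LinearMap.map_sub, LinearMap.map_add] at h
    simp only [mehlerCoeff]
    norm_num
    linear_combination h
  · have h := congrArg (gammaFunctional β) (mehlerPoly_recurrence x y n)
    simp only [hX, gammaFunctional_C_mul, LinearMap.map_sub, LinearMap.map_add] at h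
    simp only [mehlerCoeff]
    rcases n with _ | n
    · norm_num at h ⊢
      linear_combination h
    · simp only [show ∀ k ≤ 4, k ≤ n + 1 + 1 + 1 + 1 from fun k hk => by omega, le_refl,
        show 1 ≤ 4 by norm_num, show 2 ≤ 4 by norm_num, show 3 ≤ 4 by norm_num, if_true,
        show n + 1 + 1 + 1 + 1 - 1 = n + 1 + 2 by omega,
        show n + 1 + 1 + 1 + 1 - 2 = n + 1 + 1 by omega,
        show n + 1 + 1 + 1 + 1 - 3 = n + 1 by omega,
        show n + 1 + 1 + 1 + 1 - 4 = n by omega]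
      push_cast at h ⊢
      linear_combination h

-- Both families solve the same `KernelEq` and have constant term 1. This replaces the analytic
-- averaging of Mehler's formula and holds for all complex β.
open PowerSeries in
lemma kernelSeries_eq (x y u v β : ℂ) (h1 : u + v = 2 * x * y) (h2 : u * v = x ^ 2 + y ^ 2 - 1) :
    kernelSeries u v β = .mk (mehlerCoeff β x y) := by
  have h := kernelEq_kernelSeries u v
  rw [h1, h2, show 2 * (x ^ 2 + y ^ 2 - 1 + 1) = 2 * (x ^ 2 + y ^ 2) by ring] at h
  refine h.unique (kernelEq_mehlerCoeff x y) (fun β => ?_) β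
  have : gammaFunctional β 1 = 1 := by
    simpa using gammaFunctional_C_mul_X_pow β 1 0
  have hb : ∀ c w, constantCoeff (binSeries c w) = 1 := fun c w => by
    rw [← coeff_zero_eq_constantCoeff_apply, coeff_binSeries]; simp
  have hm : constantCoeff (PowerSeries.mk (mehlerCoeff β x y)) = 1 := by
    rw [← coeff_zero_eq_constantCoeff_apply, coeff_mk, mehlerCoeff, mehlerPoly_zero, this]
  rw [hm]
  simp [kernelSeries, hb]

end

end SOpq

/-! ### Convergence and the Taylor expansion in tanh α -/

namespace SOpq
open Finset PowerSeries

noncomputable section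

/-- The terms of `φ` at radius `T` are dominated by the summable sequence `F`. -/
def DominatedBy (φ : PowerSeries ℂ) (T : ℝ) (F : ℕ → ℝ) : Prop :=
  Summable F ∧ ∀ n, ‖coeff n φ‖ * T ^ n ≤ F n

lemma DominatedBy.summable_norm {φ : PowerSeries ℂ} {t : ℂ} {F : ℕ → ℝ}
    (h : DominatedBy φ ‖t‖ F) : Summable fun n => ‖coeff n φ * t ^ n‖ :=
  h.1.of_nonneg_of_le (fun _ => norm_nonneg _) fun n => by
    rw [norm_mul, norm_pow]; exact h.2 n

lemma DominatedBy.mul {φ ψ : PowerSeries ℂ} {T : ℝ} {F G : ℕ → ℝ} (hT : 0 ≤ T)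
    (hφ : DominatedBy φ T F) (hψ : DominatedBy ψ T G) :
    DominatedBy (φ * ψ) T fun n => ∑ ij ∈ antidiagonal n, F ij.1 * G ij.2 := by
  have hF : ∀ n, 0 ≤ F n := fun n => le_trans (by positivity) (hφ.2 n)
  have hG : ∀ n, 0 ≤ G n := fun n => le_trans (by positivity) (hψ.2 n)
  refine ⟨summable_sum_mul_antidiagonal_of_summable_mul
    (Summable.mul_of_nonneg hφ.1 hψ.1 hF hG), fun n => ?_⟩
  rw [coeff_mul]
  calc _ ≤ (∑ ij ∈ antidiagonal n, ‖coeff ij.1 φ * coeff ij.2 ψ‖) * T ^ n := by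
        gcongr; exact norm_sum_le _ _
    _ ≤ _ := by
        rw [sum_mul]
        refine sum_le_sum fun ij hij => ?_
        rw [HasAntidiagonal.mem_antidiagonal] at hij
        rw [norm_mul, ← hij, pow_add]
        calc _ = (‖coeff ij.1 φ‖ * T ^ ij.1) * (‖coeff ij.2 ψ‖ * T ^ ij.2) := by ring
          _ ≤ _ := mul_le_mul (hφ.2 _) (hψ.2 _) (by positivity) (hF _)

lemma hasSum_coeff_mul {φ ψ : PowerSeries ℂ} {t a b : ℂ}
    (hφ : Summable fun n => ‖coeff n φ * t ^ n‖) (hψ : Summable fun n => ‖coeff n ψ * t ^ n‖)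
    (ha : HasSum (fun n => coeff n φ * t ^ n) a) (hb : HasSum (fun n => coeff n ψ * t ^ n) b) :
    HasSum (fun n => coeff n (φ * ψ) * t ^ n) (a * b) := by
  have e : (fun n => coeff n (φ * ψ) * t ^ n) = fun n =>
      ∑ ij ∈ antidiagonal n, (coeff ij.1 φ * t ^ ij.1) * (coeff ij.2 ψ * t ^ ij.2) := by
    funext n
    rw [coeff_mul, sum_mul]
    refine sum_congr rfl fun ij hij => ?_
    rw [HasAntidiagonal.mem_antidiagonal] at hij
    rw [← hij, pow_add]; ring
  rw [e, ← ha.tsum_eq, ← hb.tsum_eq,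
    tsum_mul_tsum_eq_tsum_sum_antidiagonal_of_summable_norm hφ hψ]
  exact (summable_norm_sum_mul_antidiagonal_of_summable_norm hφ hψ).of_norm.hasSum

lemma multichoose_eq_poch_div (c : ℂ) (n : ℕ) :
    Ring.choose (c + n - 1) n = poch c n / (n.factorial : ℂ) := by
  have hf : (n.factorial : ℂ) ≠ 0 := by exact_mod_cast n.factorial_ne_zero
  have h := Ring.factorial_nsmul_multichoose_eq_ascPochhammer c n
  rw [Ring.choose, show c + n - 1 - n + 1 = c by ring, eq_div_iff hf, mul_comm,
    ← nsmul_eq_mul, h, poch, Polynomial.ascPochhammer_smeval_eq_eval]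

lemma hasSum_poch_div (c : ℂ) {z : ℂ} (hz : ‖z‖ < 1) :
    HasSum (fun n => poch c n / (n.factorial : ℂ) * z ^ n) ((1 - z) ^ (-c)) := by
  have h := (Complex.one_div_one_sub_cpow_hasFPowerSeriesOnBall_zero c).hasSum (y := z)
    (by rw [Metric.mem_eball, edist_zero_right, ← ofReal_norm, ENNReal.ofReal_lt_one]; exact hz)
  simpa [FormalMultilinearSeries.ofScalars_apply_eq, multichoose_eq_poch_div, Complex.cpow_neg,
    mul_comm] using h

lemma summable_norm_poch_div (c : ℂ) {T : ℝ} (h0 : 0 ≤ T) (hT : T < 1) :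
    Summable fun n => ‖poch c n / (n.factorial : ℂ)‖ * T ^ n := by
  have h : Summable (fun n => poch c n / (n.factorial : ℂ) * (T : ℂ) ^ n) :=
    (hasSum_poch_div c (by simpa [abs_of_nonneg h0] using hT)).summable
  simpa [abs_of_nonneg h0] using h.norm

lemma dominatedBy_binSeries (c : ℂ) {w : ℂ} (hw : ‖w‖ ≤ 1) {T : ℝ} (h0 : 0 ≤ T) (hT : T < 1) :
    DominatedBy (binSeries c w) T fun n => ‖poch c n / (n.factorial : ℂ)‖ * T ^ n := by
  refine ⟨summable_norm_poch_div c h0 hT, fun n => ?_⟩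
  rw [coeff_binSeries, norm_mul, norm_pow]
  have : ‖w‖ ^ n ≤ 1 := pow_le_one₀ (norm_nonneg _) hw
  exact mul_le_mul_of_nonneg_right (mul_le_of_le_one_right (norm_nonneg _) this) (by positivity)

lemma hasSum_binSeries (c : ℂ) {w t : ℂ} (hw : ‖w‖ ≤ 1) (ht : ‖t‖ < 1) :
    HasSum (fun n => coeff n (binSeries c w) * t ^ n) ((1 - w * t) ^ (-c)) := by
  have h : ‖w * t‖ < 1 := by
    rw [norm_mul]
    exact lt_of_le_of_lt (mul_le_of_le_one_left (norm_nonneg _) hw) ht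
  convert hasSum_poch_div c h using 2 with n
  rw [coeff_binSeries, mul_pow]; ring

/-- A bound of the terms of `kernelSeries u v β`, uniform in `u` and `v`. -/
lemma exists_dominatedBy_kernelSeries (β : ℂ) {T : ℝ} (h0 : 0 ≤ T) (hT : T < 1) :
    ∃ F : ℕ → ℝ, ∀ u v : ℂ, ‖u‖ ≤ 1 → ‖v‖ ≤ 1 → DominatedBy (kernelSeries u v β) T F := by
  let B : ℂ → ℕ → ℝ := fun c n => ‖poch c n / (n.factorial : ℂ)‖ * T ^ n
  let cauchy : (ℕ → ℝ) → (ℕ → ℝ) → ℕ → ℝ := fun F G n => ∑ ij ∈ antidiagonal n, F ij.1 * G ij.2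
  refine ⟨cauchy (cauchy (cauchy (B (1 / 2 - β)) (B (1 / 2 - β))) (B β)) (B β),
    fun u v hu hv => ?_⟩
  exact (((dominatedBy_binSeries _ (by simp) h0 hT).mul h0
    (dominatedBy_binSeries _ (by simp) h0 hT)).mul h0
    (dominatedBy_binSeries _ hu h0 hT)).mul h0 (dominatedBy_binSeries _ hv h0 hT)

lemma hasSum_kernelSeries (β : ℂ) {u v t : ℂ} (hu : ‖u‖ ≤ 1) (hv : ‖v‖ ≤ 1) (ht : ‖t‖ < 1) :
    HasSum (fun n => coeff n (kernelSeries u v β) * t ^ n)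
      ((1 - t) ^ (-(1 / 2 - β)) * (1 + t) ^ (-(1 / 2 - β)) * (1 - u * t) ^ (-β) *
        (1 - v * t) ^ (-β)) := by
  have d1 := dominatedBy_binSeries (1 / 2 - β) (w := 1) (by simp) (norm_nonneg t) ht
  have d2 := dominatedBy_binSeries (1 / 2 - β) (w := -1) (by simp) (norm_nonneg t) ht
  have d3 := dominatedBy_binSeries β hu (norm_nonneg t) ht
  have d4 := dominatedBy_binSeries β hv (norm_nonneg t) ht
  have d12 := d1.mul (norm_nonneg t) d2
  have d123 := d12.mul (norm_nonneg t) d3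
  have h := hasSum_coeff_mul d123.summable_norm d4.summable_norm
    (hasSum_coeff_mul d12.summable_norm d3.summable_norm
    (hasSum_coeff_mul d1.summable_norm d2.summable_norm
    (hasSum_binSeries _ (by simp) ht) (hasSum_binSeries _ (by simp) ht))
    (hasSum_binSeries _ hu ht)) (hasSum_binSeries _ hv ht)
  simpa [kernelSeries] using h

/-- For x = cos θ and y = cos φ the roots are cos(θ - φ) and cos(θ + φ). -/
lemma exists_kernel_params {x y : ℝ} (hx : x ^ 2 ≤ 1) (hy : y ^ 2 ≤ 1) :
    ∃ u v : ℝ, |u| ≤ 1 ∧ |v| ≤ 1 ∧ u + v = 2 * x * y ∧ u * v = x ^ 2 + y ^ 2 - 1 := by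
  have ha := Real.sq_sqrt (sub_nonneg.mpr hx)
  have hb := Real.sq_sqrt (sub_nonneg.mpr hy)
  set a := √(1 - x ^ 2)
  set b := √(1 - y ^ 2)
  refine ⟨x * y + a * b, x * y - a * b, ?_, ?_, by ring, ?_⟩
  · rw [← sq_le_one_iff_abs_le_one]
    nlinarith [sq_nonneg (x * b - a * y)]
  · rw [← sq_le_one_iff_abs_le_one]
    nlinarith [sq_nonneg (x * b + a * y)]
  · linear_combination -(b ^ 2) * ha - (1 - x ^ 2) * hb

/-- `(cosh α)² (1 - u tanh α) (1 - v tanh α) = Λ`. -/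
lemma Lam_eq (α : ℝ) {x y u v : ℝ} (h1 : u + v = 2 * x * y) (h2 : u * v = x ^ 2 + y ^ 2 - 1) :
    Lam α x y = Real.cosh α ^ 2 * ((1 - u * Real.tanh α) * (1 - v * Real.tanh α)) := by
  have hc : Real.cosh α ≠ 0 := (Real.cosh_pos α).ne'
  have hs := Real.cosh_sq α
  rw [Lam, Real.tanh_eq_sinh_div_cosh]
  field_simp
  linear_combination (-1) * hs + (Real.sinh α * Real.cosh α) * h1 - Real.sinh α ^ 2 * h2

/-- The Taylor expansion of `cosh α · Λ^{σ/2}` in powers of `tanh α`. -/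
lemma hasSum_mehlerCoeff (σ : ℂ) (α : ℝ) {x y : ℝ} (hx : x ^ 2 ≤ 1) (hy : y ^ 2 ≤ 1) :
    HasSum (fun n => mehlerCoeff (-σ / 2) x y n * (Real.tanh α : ℂ) ^ n)
      ((Real.cosh α : ℂ) * LamPow σ α x y) := by
  obtain ⟨u, v, hu, hv, h1, h2⟩ := exists_kernel_params hx hy
  have ht := Real.abs_tanh_lt_one α
  have hk := kernelSeries_eq (x : ℂ) y u v (-σ / 2) (by exact_mod_cast h1) (by exact_mod_cast h2)
  have h := hasSum_kernelSeries (-σ / 2) (u := (u : ℂ)) (v := (v : ℂ)) (t := (Real.tanh α : ℂ))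
    (by simpa using hu) (by simpa using hv) (by rwa [Complex.norm_real, Real.norm_eq_abs])
  rw [hk] at h
  simp only [coeff_mk] at h
  convert h using 1
  have hc := Real.cosh_pos α
  set t := Real.tanh α with htdef
  obtain ⟨ht1, ht2⟩ := abs_lt.mp ht
  have pos : ∀ w : ℝ, |w| ≤ 1 → 0 < 1 - w * t := by
    intro w hw
    have : |w * t| < 1 := by
      rw [abs_mul]; exact lt_of_le_of_lt (mul_le_of_le_one_left (abs_nonneg _) hw) ht
    linarith [(abs_lt.mp this).2]
  have hcosh : (1 - t) * (1 + t) = (Real.cosh α ^ 2)⁻¹ := by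
    have hs := Real.cosh_sq α
    rw [htdef, Real.tanh_eq_sinh_div_cosh]
    field_simp
    linarith
  -- The exponent 1/2 yields the extra factor cosh α of the statement; the exponent σ/2 yields the
  -- cosh² α in the factorization of Λ. All bases are positive, so principal powers multiply.
  have e1 : (1 - (t : ℂ)) ^ (-(1 / 2 - -σ / 2)) * (1 + (t : ℂ)) ^ (-(1 / 2 - -σ / 2)) =
      (Real.cosh α : ℂ) * (((Real.cosh α ^ 2 : ℝ) : ℂ)) ^ (σ / 2) := by
    have a1 : (1 - (t : ℂ)) = ((1 - t : ℝ) : ℂ) := by push_cast; rfl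
    have a2 : (1 + (t : ℂ)) = ((1 + t : ℝ) : ℂ) := by push_cast; rfl
    rw [a1, a2, ← Complex.mul_cpow_ofReal_nonneg (by linarith) (by linarith), ← Complex.ofReal_mul,
      hcosh, Complex.ofReal_inv, Complex.inv_cpow _ _ ?_, ← Complex.cpow_neg,
      show -(-(1 / 2 - -σ / 2)) = 1 / 2 + σ / 2 by ring, Complex.cpow_add]
    · congr 1
      have := Complex.ofReal_cpow (sq_nonneg (Real.cosh α)) (1 / 2)
      rw [← Real.sqrt_eq_rpow, Real.sqrt_sq hc.le] at this
      push_cast at this ⊢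
      exact this.symm
    · exact_mod_cast (pow_pos hc 2).ne'
    · rw [Complex.arg_ofReal_of_nonneg (by positivity)]
      exact Real.pi_pos.ne
  have e2 : -(-σ / 2) = σ / 2 := by ring
  have b1 : (1 - (u : ℂ) * t) = ((1 - u * t : ℝ) : ℂ) := by push_cast; rfl
  have b2 : (1 - (v : ℂ) * t) = ((1 - v * t : ℝ) : ℂ) := by push_cast; rfl
  rw [e1, e2, b1, b2, LamPow, Lam_eq α h1 h2, Complex.ofReal_mul,
    Complex.mul_cpow_ofReal_nonneg (by positivity) (mul_nonneg (pos u hu).le (pos v hv).le),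
    Complex.ofReal_mul, Complex.mul_cpow_ofReal_nonneg (pos u hu).le (pos v hv).le]
  ring

/-- Since |u|, |v| ≤ 1 on the whole square, the bound does not depend on x and y; this is what
termwise integration requires. -/
lemma exists_bound_mehlerCoeff (β : ℂ) {t : ℝ} (ht : |t| < 1) :
    ∃ F : ℕ → ℝ, Summable F ∧ ∀ x y : ℝ, x ^ 2 ≤ 1 → y ^ 2 ≤ 1 → ∀ n,
      ‖mehlerCoeff β x y n * (t : ℂ) ^ n‖ ≤ F n := by
  obtain ⟨F, hF⟩ := exists_dominatedBy_kernelSeries β (abs_nonneg t) ht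
  refine ⟨F, (hF 1 1 (by simp) (by simp)).1, fun x y hx hy n => ?_⟩
  obtain ⟨u, v, hu, hv, h1, h2⟩ := exists_kernel_params hx hy
  have hk := kernelSeries_eq (x : ℂ) y u v β (by exact_mod_cast h1) (by exact_mod_cast h2)
  have h := (hF u v (by simpa using hu) (by simpa using hv)).2 n
  rw [hk, coeff_mk] at h
  simpa using h

end

end SOpq

/-! ### Moments of the Gegenbauer polynomials -/

namespace SOpq
open Finset intervalIntegral

noncomputable section

/-- The moments of the weight `(1 - x²)^e`. -/
def weightMoment (e : ℝ) (k : ℕ) : ℝ := ∫ x in (-1 : ℝ)..1, x ^ k * (1 - x ^ 2) ^ e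

lemma continuous_one_sub_sq_rpow {e : ℝ} (he : 0 ≤ e) :
    Continuous fun x : ℝ => (1 - x ^ 2) ^ e :=
  Continuous.rpow_const (by fun_prop) fun _ => Or.inr he

lemma weightMoment_of_odd (e : ℝ) {k : ℕ} (hk : Odd k) : weightMoment e k = 0 := by
  have h := integral_comp_neg (a := -1) (b := 1) fun x : ℝ => x ^ k * (1 - x ^ 2) ^ e
  simp only [hk.neg_pow, neg_sq, neg_neg, neg_mul, integral_neg] at h
  rw [weightMoment]
  linarith

lemma one_sub_sq_rpow_add_one {e x : ℝ} (he : 0 ≤ e) (hx : x ∈ Set.uIcc (-1 : ℝ) 1) :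
    (1 - x ^ 2) ^ (e + 1) = (1 - x ^ 2) ^ e * (1 - x ^ 2) := by
  rw [Set.uIcc_of_le (by norm_num)] at hx
  have : 0 ≤ 1 - x ^ 2 := by nlinarith [hx.1, hx.2]
  rw [Real.rpow_add_of_nonneg this he zero_le_one, Real.rpow_one]

lemma weightMoment_add_one {e : ℝ} (he : 0 ≤ e) (k : ℕ) :
    weightMoment (e + 1) k = weightMoment e k - weightMoment e (k + 2) := by
  have hc := continuous_one_sub_sq_rpow he
  rw [weightMoment, weightMoment, weightMoment, ← integral_sub
    (Continuous.intervalIntegrable (by fun_prop) _ _)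
    (Continuous.intervalIntegrable (by fun_prop) _ _)]
  refine integral_congr fun x hx => ?_
  simp only [one_sub_sq_rpow_add_one he hx]
  ring

/-- The derivative of x^(k+1) (1 - x²)^(e+1) integrates to zero, because e + 1 > 0 makes the
boundary values vanish. -/
lemma weightMoment_recurrence {e : ℝ} (he : 0 ≤ e) (k : ℕ) :
    ((k : ℝ) + 2 * e + 3) * weightMoment e (k + 2) = (k + 1) * weightMoment e k := by
  have hc := continuous_one_sub_sq_rpow he
  have hc' := continuous_one_sub_sq_rpow (e := e + 1) (by linarith)
  have hd : ∀ x ∈ Set.uIcc (-1 : ℝ) 1, HasDerivAt (fun x : ℝ => x ^ (k + 1) * (1 - x ^ 2) ^ (e + 1))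
      (((k : ℝ) + 1) * (x ^ k * (1 - x ^ 2) ^ (e + 1)) -
        2 * (e + 1) * (x ^ (k + 2) * (1 - x ^ 2) ^ e)) x := by
    intro x _
    have h1 : HasDerivAt (fun x : ℝ => 1 - x ^ 2) (-(2 * x)) x := by
      simpa using (hasDerivAt_pow 2 x).const_sub 1
    have h2 := h1.rpow_const (p := e + 1) (Or.inr (by linarith))
    have h3 := (hasDerivAt_pow (k + 1) x).mul h2
    refine h3.congr_deriv ?_
    rw [show k + 1 - 1 = k by omega, add_sub_cancel_right]
    push_cast
    ring
  have hi := integral_eq_sub_of_hasDerivAt hd (Continuous.intervalIntegrable (by fun_prop) _ _)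
  have h0 : (0 : ℝ) ^ (e + 1) = 0 := Real.zero_rpow (by linarith)
  rw [integral_sub (Continuous.intervalIntegrable (by fun_prop) _ _)
    (Continuous.intervalIntegrable (by fun_prop) _ _), integral_const_mul, integral_const_mul] at hi
  have h1 := weightMoment_add_one he k
  rw [weightMoment] at h1
  have h2 : ∫ x in (-1 : ℝ)..1, x ^ (k + 2) * (1 - x ^ 2) ^ e = weightMoment e (k + 2) := rfl
  rw [h1, h2] at hi
  norm_num [h0] at hi
  linarith

/-- Raising the exponent by 1 is controlled by the moment recurrence, so half-integers need two
starting values: the length of the interval and the area of a half disc. -/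
lemma weightMoment_zero (n : ℕ) :
    weightMoment ((n : ℝ) / 2) 0 =
      √Real.pi * Real.Gamma ((n : ℝ) / 2 + 1) / Real.Gamma ((n : ℝ) / 2 + 3 / 2) := by
  have h32 : Real.Gamma (3 / 2) = √Real.pi / 2 := by
    rw [show (3 / 2 : ℝ) = 1 / 2 + 1 by norm_num, Real.Gamma_add_one (by norm_num),
      Real.Gamma_one_half_eq]
    ring
  have hpi : √Real.pi ≠ 0 := (Real.sqrt_pos.mpr Real.pi_pos).ne'
  induction n using Nat.twoStepInduction with
  | zero =>
    simp only [weightMoment, Nat.cast_zero, zero_div, Real.rpow_zero, zero_add, h32, Real.Gamma_one]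
    norm_num
    field_simp
  | one =>
    have e1 : ((1 : ℕ) : ℝ) / 2 + 1 = 3 / 2 := by norm_num
    have e2 : ((1 : ℕ) : ℝ) / 2 + 3 / 2 = 1 + 1 := by norm_num
    rw [e1, e2, h32, Real.Gamma_add_one one_ne_zero, Real.Gamma_one]
    simp only [weightMoment, Nat.cast_one, ← Real.sqrt_eq_rpow, pow_zero, one_mul,
      integral_sqrt_one_sub_sq, div_one]
    nlinarith [Real.sq_sqrt Real.pi_pos.le]
  | more n ih _ =>
    have hn : (0 : ℝ) ≤ (n : ℝ) / 2 := by positivity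
    have h1 := weightMoment_recurrence hn 0
    have e : ((n + 2 : ℕ) : ℝ) / 2 = (n : ℝ) / 2 + 1 := by push_cast; ring
    rw [e, weightMoment_add_one hn, show (n : ℝ) / 2 + 1 + 3 / 2 = (n : ℝ) / 2 + 3 / 2 + 1 by ring,
      Real.Gamma_add_one (s := (n : ℝ) / 2 + 1) (by positivity),
      Real.Gamma_add_one (s := (n : ℝ) / 2 + 3 / 2) (by positivity)]
    have hG : Real.Gamma ((n : ℝ) / 2 + 3 / 2) ≠ 0 := (Real.Gamma_pos_of_pos (by positivity)).ne'
    have hk : ((n : ℝ) + 3) ≠ 0 := by positivity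
    have h2 : weightMoment ((n : ℝ) / 2) (0 + 2) = weightMoment ((n : ℝ) / 2) 0 / (n + 3) := by
      rw [eq_div_iff hk]
      simp only [Nat.cast_zero, zero_add] at h1 ⊢
      linear_combination h1
    have hq : ((n : ℝ) / 2 + 3 / 2) ≠ 0 := by positivity
    rw [h2, ih]
    field_simp
    ring

lemma weightMoment_even {e : ℝ} (he : 0 ≤ e) (i : ℕ) :
    weightMoment e (2 * i) = weightMoment e 0 * (((2 * i).factorial : ℝ) /
      (4 ^ i * (i.factorial : ℝ) * (ascPochhammer ℝ i).eval (e + 3 / 2))) := by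
  induction i with
  | zero => simp
  | succ i ih =>
    have h := weightMoment_recurrence he (2 * i)
    have hp : (ascPochhammer ℝ i).eval (e + 3 / 2) ≠ 0 :=
      (ascPochhammer_pos i _ (by linarith)).ne'
    have h1 : ((2 * i : ℕ) : ℝ) + 2 * e + 3 ≠ 0 := by positivity
    have h2 : e + 3 / 2 + i ≠ 0 := by positivity
    have h3 : weightMoment e (2 * i + 2) =
        (((2 * i : ℕ) : ℝ) + 1) * weightMoment e (2 * i) / (((2 * i : ℕ) : ℝ) + 2 * e + 3) := by
      rw [eq_div_iff h1]; linear_combination h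
    rw [show 2 * (i + 1) = 2 * i + 2 by ring, h3, ih, ascPochhammer_succ_eval,
      show 2 * i + 2 = (2 * i + 1) + 1 by ring, Nat.factorial_succ (2 * i + 1),
      Nat.factorial_succ (2 * i), Nat.factorial_succ i]
    push_cast at h1 ⊢
    field_simp
    ring

lemma gegenbauer_eq (n : ℕ) (κ x : ℝ) : gegenbauer n κ x = ∑ k ∈ range (n / 2 + 1),
    ((-1) ^ k * (ascPochhammer ℝ (n - k)).eval κ /
      ((k.factorial : ℝ) * ((n - 2 * k).factorial : ℝ))) * (2 * x) ^ (n - 2 * k) := rfl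

lemma gegenbauer_zero (κ x : ℝ) : gegenbauer 0 κ x = 1 := by simp [gegenbauer]

lemma gegenbauer_one (κ x : ℝ) : gegenbauer 1 κ x = 2 * κ * x := by
  simp [gegenbauer]; ring

lemma gegenbauer_recurrence (n : ℕ) (κ x : ℝ) :
    ((n : ℝ) + 2) * gegenbauer (n + 2) κ x =
      (n + 1 + κ) * (2 * x) * gegenbauer (n + 1) κ x - (n + 2 * κ) * gegenbauer n κ x := by
  have hf : ∀ m : ℕ, (m.factorial : ℝ) ≠ 0 := fun m => by exact_mod_cast m.factorial_ne_zero
  rw [gegenbauer_eq, gegenbauer_eq, gegenbauer_eq]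
  refine half_sum_recurrence (fun n k => (-1) ^ k * (ascPochhammer ℝ (n - k)).eval κ /
      ((k.factorial : ℝ) * ((n - 2 * k).factorial : ℝ))) (2 * x) n ((n : ℝ) + 2) (n + 1 + κ)
      (n + 2 * κ) ?_ ?_ ?_
  · have h1 := hf (n + 1)
    have h2 : ((n : ℝ) + 2) ≠ 0 := by positivity
    simp only [mul_zero, tsub_zero, Nat.factorial_succ (n + 1), pow_zero,
      show n + 2 = n + 1 + 1 by ring, ascPochhammer_succ_eval (n + 1)]
    push_cast
    rw [show (n : ℝ) + 1 + 1 = n + 2 by ring]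
    field_simp
    ring
  · intro k hk
    obtain ⟨m, rfl⟩ := Nat.exists_eq_add_of_le hk
    have e1 : 2 * k + 1 + m + 2 - 2 * (k + 1) = m + 1 := by omega
    have e2 : 2 * k + 1 + m + 1 - 2 * (k + 1) = m := by omega
    have e3 : 2 * k + 1 + m - 2 * k = m + 1 := by omega
    have e4 : 2 * k + 1 + m + 2 - (k + 1) = k + m + 1 + 1 := by omega
    have e5 : 2 * k + 1 + m + 1 - (k + 1) = k + m + 1 := by omega
    have e6 : 2 * k + 1 + m - k = k + m + 1 := by omega
    have h1 := hf m
    have h2 := hf k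
    simp only [e1, e2, e3, e4, e5, e6, Nat.factorial_succ, ascPochhammer_succ_eval (k + m + 1)]
    push_cast
    field_simp
    ring
  · intro k hk
    subst hk
    have h2 := hf k
    have e1 : 2 * k + 2 - 2 * (k + 1) = 0 := by omega
    have e2 : 2 * k + 2 - (k + 1) = k + 1 := by omega
    have e3 : 2 * k - k = k := by omega
    simp only [e1, e2, e3, Nat.factorial_succ, Nat.sub_self, ascPochhammer_succ_eval]
    push_cast
    field_simp
    ring

lemma continuous_gegenbauer (n : ℕ) (κ : ℝ) : Continuous (gegenbauer n κ) := by
  unfold gegenbauer; fun_prop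

/-- The moments of `C_l^κ` with respect to the weight `(1 - x²)^{κ - 1/2}`. -/
def gegenbauerMoment (κ : ℝ) (l k : ℕ) : ℝ :=
  ∫ x in (-1 : ℝ)..1, x ^ k * gegenbauer l κ x * (1 - x ^ 2) ^ (κ - 1 / 2)

lemma gegenbauerMoment_recurrence {κ : ℝ} (hκ : 1 / 2 ≤ κ) (l k : ℕ) :
    ((l : ℝ) + 2) * gegenbauerMoment κ (l + 2) k =
      2 * (l + 1 + κ) * gegenbauerMoment κ (l + 1) (k + 1) -
        (l + 2 * κ) * gegenbauerMoment κ l k := by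
  have hc := continuous_one_sub_sq_rpow (e := κ - 1 / 2) (by linarith)
  have hg := fun m => continuous_gegenbauer m κ
  simp only [gegenbauerMoment]
  rw [← integral_const_mul, ← integral_const_mul, ← integral_const_mul,
    ← integral_sub (Continuous.intervalIntegrable (by fun_prop) _ _)
      (Continuous.intervalIntegrable (by fun_prop) _ _)]
  refine integral_congr fun x _ => ?_
  linear_combination (x ^ k * (1 - x ^ 2) ^ (κ - 1 / 2)) * gegenbauer_recurrence l κ x

/-- The ratio between the moments of `C_l^κ` and their standard form. -/
def gegenbauerConst (κ : ℝ) (l : ℕ) : ℝ := weightMoment (κ - 1 / 2) 0 *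
  ((ascPochhammer ℝ l).eval (2 * κ) /
    (2 ^ l * (l.factorial : ℝ) * (ascPochhammer ℝ l).eval (κ + 1)))

lemma ascPochhammer_eval_succ_left (a : ℝ) (n : ℕ) :
    (ascPochhammer ℝ (n + 1)).eval a = a * (ascPochhammer ℝ n).eval (a + 1) := by
  simp [ascPochhammer_succ_left]

/-- Induction on l by the three-term recurrence. The vanishing part contains both parity and
orthogonality to lower powers, and is carried along with the values. -/
lemma gegenbauerMoment_eq {κ : ℝ} (hκ : 1 / 2 ≤ κ) (l : ℕ) :
    (∀ i, gegenbauerMoment κ l (l + 2 * i) = gegenbauerConst κ l * (((l + 2 * i).factorial : ℝ) /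
      (4 ^ i * (i.factorial : ℝ) * (ascPochhammer ℝ i).eval (l + κ + 1)))) ∧
    ∀ k, (∀ i, k ≠ l + 2 * i) → gegenbauerMoment κ l k = 0 := by
  have he : 0 ≤ κ - 1 / 2 := by linarith
  induction l using Nat.twoStepInduction with
  | zero =>
    have h0 : ∀ k, gegenbauerMoment κ 0 k = weightMoment (κ - 1 / 2) k := by
      intro k
      simp only [gegenbauerMoment, gegenbauer_zero, mul_one, weightMoment]
    refine ⟨fun i => ?_, fun k hk => ?_⟩
    · rw [h0, zero_add, weightMoment_even he, show κ - 1 / 2 + 3 / 2 = κ + 1 by ring]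
      simp [gegenbauerConst]
    · rw [h0]
      refine weightMoment_of_odd _ ?_
      rw [← Nat.not_even_iff_odd]
      rintro ⟨i, hi⟩
      exact hk i (by omega)
  | one =>
    have h0 : ∀ k, gegenbauerMoment κ 1 k = 2 * κ * weightMoment (κ - 1 / 2) (k + 1) := by
      intro k
      simp only [gegenbauerMoment, gegenbauer_one, weightMoment, ← integral_const_mul]
      congr 1
      funext x
      ring
    refine ⟨fun i => ?_, fun k hk => ?_⟩
    · have hp := (ascPochhammer_pos i (κ + 1 + 1) (by linarith)).ne'
      rw [h0, show 1 + 2 * i + 1 = 2 * (i + 1) by ring, weightMoment_even he,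
        show κ - 1 / 2 + 3 / 2 = κ + 1 by ring, ascPochhammer_eval_succ_left,
        show 2 * (i + 1) = (1 + 2 * i) + 1 by ring, Nat.factorial_succ (1 + 2 * i),
        Nat.factorial_succ i, Nat.cast_one, show 1 + κ + 1 = κ + 1 + 1 by ring]
      simp only [gegenbauerConst, ascPochhammer_one, Polynomial.eval_X, Nat.factorial_one,
        Nat.cast_one]
      have : κ + 1 ≠ 0 := by linarith
      push_cast
      field_simp
      ring
    · rw [h0, weightMoment_of_odd, mul_zero]
      rw [← Nat.not_even_iff_odd]
      rintro ⟨i, hi⟩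
      exact hk (i - 1) (by omega)
  | more l ih0 ih1 =>
    have hl : ((l : ℝ) + 2) ≠ 0 := by positivity
    have hrec : ∀ k, gegenbauerMoment κ (l + 2) k =
        (2 * (l + 1 + κ) * gegenbauerMoment κ (l + 1) (k + 1) -
        (l + 2 * κ) * gegenbauerMoment κ l k) / (l + 2) := by
      intro k
      rw [eq_div_iff hl, mul_comm, gegenbauerMoment_recurrence hκ]
    have hq := (ascPochhammer_pos l (κ + 1) (by linarith)).ne'
    have p1 : κ + 1 + l ≠ 0 := by positivity
    have p2 : κ + 1 + (l + 1) ≠ 0 := by positivity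
    have c1 : gegenbauerConst κ (l + 1) =
        gegenbauerConst κ l * ((2 * κ + l) / (2 * (l + 1) * (κ + 1 + l))) := by
      simp only [gegenbauerConst, ascPochhammer_succ_eval, Nat.factorial_succ]
      push_cast
      field_simp
      ring
    have c2 : gegenbauerConst κ (l + 2) =
        gegenbauerConst κ (l + 1) * ((2 * κ + (l + 1)) / (2 * (l + 2) * (κ + 1 + (l + 1)))) := by
      simp only [gegenbauerConst, ascPochhammer_succ_eval, Nat.factorial_succ]
      push_cast
      rw [show (l : ℝ) + 1 + 1 = l + 2 by ring]
      field_simp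
      ring
    refine ⟨fun i => ?_, fun k hk => ?_⟩
    · rw [hrec, show l + 2 + 2 * i + 1 = l + 1 + 2 * (i + 1) by ring, ih1.1,
        show l + 2 + 2 * i = l + 2 * (i + 1) by ring, ih0.1, c2, c1]
      have hp := (ascPochhammer_pos i (l + κ + 1 + 1 + 1) (by positivity)).ne'
      have p3 : (l : ℝ) + κ + 1 + 1 + i ≠ 0 := by positivity
      have p4 : (l : ℝ) + κ + 1 + 1 ≠ 0 := by positivity
      have q1 : (ascPochhammer ℝ i).eval ((l : ℝ) + κ + 1 + 1) =
          (l + κ + 1 + 1) * (ascPochhammer ℝ i).eval (l + κ + 1 + 1 + 1) /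
            (l + κ + 1 + 1 + i) := by
        rw [eq_div_iff p3, ← ascPochhammer_eval_succ_left, ascPochhammer_succ_eval]
      have r1 : ((l + 1 : ℕ) : ℝ) + κ + 1 = l + κ + 1 + 1 := by push_cast; ring
      have r2 : ((l + 2 : ℕ) : ℝ) + κ + 1 = l + κ + 1 + 1 + 1 := by push_cast; ring
      rw [r1, r2, ascPochhammer_eval_succ_left (l + κ + 1) i,
        ascPochhammer_eval_succ_left (l + κ + 1 + 1) i, q1,
        show l + 1 + 2 * (i + 1) = l + 2 * (i + 1) + 1 by ring,
        Nat.factorial_succ (l + 2 * (i + 1)), Nat.factorial_succ i]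
      have p5 : (l : ℝ) + κ + 1 ≠ 0 := by positivity
      have p6 : (l : ℝ) + 1 ≠ 0 := by positivity
      rw [show κ + 1 + (l : ℝ) = l + κ + 1 by ring,
        show κ + 1 + ((l : ℝ) + 1) = l + κ + 1 + 1 by ring]
      push_cast
      field_simp
      ring
    · rw [hrec]
      -- At k = l neither vanishing hypothesis applies: the two terms of the recurrence are given by
      -- their explicit values and cancel.
      by_cases h : k = l
      · subst h
        have a1 := ih1.1 0
        have a0 := ih0.1 0
        simp only [mul_zero, add_zero] at a1 a0
        rw [a1, a0, c1, Nat.factorial_succ, div_eq_zero_iff]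
        left
        simp only [ascPochhammer_zero, Polynomial.eval_one, pow_zero, Nat.factorial_zero]
        push_cast
        field_simp
        ring
      · rw [ih1.2 (k + 1) (fun i hi => ?_), ih0.2 k (fun i hi => ?_)]
        · simp
        · rcases i with _ | i
          · exact h (by omega)
          · exact hk i (by omega)
        · rcases i with _ | i
          · exact h (by omega)
          · exact hk i (by omega)

end

end SOpq

/-! ### The common shape of the moments -/

namespace SOpq
open Finset intervalIntegral

noncomputable section

/-- The moments common to the Gegenbauer weights, the exponentials on the circle and the
two-point sphere. -/
def HasMoments (M : ℕ → ℂ) (K c : ℂ) (l : ℕ) : Prop :=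
  (∀ i, M (l + 2 * i) = K * (((l + 2 * i).factorial : ℂ) /
    (4 ^ i * (i.factorial : ℂ) * poch c i))) ∧ ∀ k, (∀ i, k ≠ l + 2 * i) → M k = 0

lemma hasMoments_gegenbauer {n : ℕ} (hn : 3 ≤ n) (l : ℕ) :
    HasMoments (fun k => ∫ x in (-1 : ℝ)..1, (x : ℂ) ^ k *
      ((gegenbauer l (((n : ℝ) - 2) / 2) x : ℂ) * (weight n x : ℂ)))
      (gegenbauerConst (((n : ℝ) - 2) / 2) l : ℂ) ((l : ℂ) + (n : ℂ) / 2) l := by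
  have hn' : (3 : ℝ) ≤ n := by exact_mod_cast hn
  obtain ⟨h1, h2⟩ := gegenbauerMoment_eq (κ := ((n : ℝ) - 2) / 2) (by linarith) l
  have hM : (fun k => ∫ x in (-1 : ℝ)..1, (x : ℂ) ^ k *
      ((gegenbauer l (((n : ℝ) - 2) / 2) x : ℂ) * (weight n x : ℂ))) =
      fun k => ((gegenbauerMoment (((n : ℝ) - 2) / 2) l k : ℝ) : ℂ) := by
    funext k
    rw [gegenbauerMoment, ← integral_ofReal]
    congr 1
    funext x
    rw [weight, show ((n : ℝ) - 2) / 2 - 1 / 2 = ((n : ℝ) - 3) / 2 by ring]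
    push_cast
    ring
  have hc : (l : ℂ) + (n : ℂ) / 2 = (((l : ℝ) + ((n : ℝ) - 2) / 2 + 1 : ℝ) : ℂ) := by
    push_cast; ring
  rw [hM, hc]
  refine ⟨fun i => ?_, fun k hk => ?_⟩
  · simp only [h1, poch_ofReal]; push_cast; rfl
  · simp only [h2 k hk, Complex.ofReal_zero]

lemma integral_exp_int_mul (m : ℤ) :
    ∫ φ in (0 : ℝ)..(2 * Real.pi), Complex.exp (Complex.I * m * φ) =
      if m = 0 then 2 * (Real.pi : ℂ) else 0 := by
  split_ifs with h
  · simp [h]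
  · have hc : Complex.I * (m : ℂ) ≠ 0 := mul_ne_zero Complex.I_ne_zero (by exact_mod_cast h)
    rw [integral_exp_mul_complex hc]
    have e : Complex.I * (m : ℂ) * ((2 * Real.pi : ℝ) : ℂ) = m * (2 * Real.pi * Complex.I) := by
      push_cast; ring
    rw [e, Complex.exp_int_mul_two_pi_mul_I]
    simp

lemma integral_cos_pow_mul_exp (l k : ℕ) :
    ∫ φ in (0 : ℝ)..(2 * Real.pi), ((Real.cos φ : ℝ) : ℂ) ^ k * Complex.exp (-Complex.I * l * φ) =
      ∑ m ∈ range (k + 1), ((k.choose m : ℂ) / 2 ^ k) *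
        if (k : ℤ) - 2 * m = l then 2 * (Real.pi : ℂ) else 0 := by
  have h : ∀ φ : ℝ, ((Real.cos φ : ℝ) : ℂ) ^ k * Complex.exp (-Complex.I * l * φ) =
      ∑ m ∈ range (k + 1), ((k.choose m : ℂ) / 2 ^ k) *
        Complex.exp (Complex.I * (((k : ℤ) - 2 * m - l : ℤ) : ℂ) * φ) := by
    intro φ
    rw [Complex.ofReal_cos, Complex.cos, add_comm, div_pow, add_pow, sum_div, sum_mul]
    refine sum_congr rfl fun m hm => ?_
    rw [mem_range] at hm
    rw [← Complex.exp_nat_mul, ← Complex.exp_nat_mul, ← Complex.exp_add, div_mul_eq_mul_div,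
      mul_right_comm, ← Complex.exp_add, Nat.cast_sub (by omega), div_mul_eq_mul_div, mul_comm]
    congr 2
    push_cast
    congr 1
    ring
  simp only [h]
  rw [integral_finsetSum fun m _ => Continuous.intervalIntegrable (by fun_prop) _ _]
  refine sum_congr rfl fun m _ => ?_
  rw [integral_const_mul, integral_exp_int_mul]
  simp only [sub_eq_zero]

/-- In the binomial expansion of cos^(l+2i) only the term m = i has frequency l; its binomial
coefficient contains (l+i)! = l! (l+1)_i. -/
lemma hasMoments_circle (l : ℕ) :
    HasMoments (fun k => ∫ φ in (0 : ℝ)..(2 * Real.pi), ((Real.cos φ : ℝ) : ℂ) ^ k *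
      Complex.exp (-Complex.I * l * φ))
      (2 * (Real.pi : ℂ) / (2 ^ l * (l.factorial : ℂ))) ((l : ℂ) + ((2 : ℕ) : ℂ) / 2) l := by
  refine ⟨fun i => ?_, fun k hk => ?_⟩
  · simp only
    rw [integral_cos_pow_mul_exp, sum_eq_single i]
    · have hf : ∀ n : ℕ, (n.factorial : ℂ) ≠ 0 := fun n => by exact_mod_cast n.factorial_ne_zero
      have h1 := factorial_mul_poch l i
      have h2 : poch ((l : ℂ) + 1) i ≠ 0 := fun h0 => hf (l + i) (by rw [← h1, h0, mul_zero])
      have h3 : ((l + 2 * i).choose i : ℂ) =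
          ((l + 2 * i).factorial : ℂ) / ((i.factorial : ℂ) * ((l + i).factorial : ℂ)) := by
        rw [Nat.cast_choose ℂ (by omega), show l + 2 * i - i = l + i by omega]
      rw [if_pos (by push_cast; ring), h3, ← h1, show ((2 : ℕ) : ℂ) / 2 = 1 by norm_num, pow_add,
        pow_mul, show (2 : ℂ) ^ 2 = 4 by norm_num]
      field_simp
    · intro m _ hm
      rw [if_neg (fun h => hm (by push_cast at h; omega)), mul_zero]
    · intro h
      exact absurd (mem_range.mpr (by omega)) h
  · simp only
    rw [integral_cos_pow_mul_exp]
    refine sum_eq_zero fun m _ => ?_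
    rw [if_neg (fun h => hk m (by omega)), mul_zero]

/-- The two new factors at each step are twice s + N + 1 and twice s + N + ν + 1/2, in an order that
depends on ν. This is the source of the numerator parameters s + 1 and s + ν + 1/2. -/
lemma factorial_add_two_mul (s N : ℕ) {ν : ℕ} (hν : ν ≤ 1) :
    ((2 * s + ν + 2 * N).factorial : ℂ) = ((2 * s + ν).factorial : ℂ) * 4 ^ N *
      poch ((s : ℂ) + 1) N * poch ((s : ℂ) + ν + 1 / 2) N := by
  induction N with
  | zero => simp
  | succ N ih =>
    rw [show 2 * s + ν + 2 * (N + 1) = 2 * s + ν + 2 * N + 1 + 1 by ring, Nat.factorial_succ,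
      Nat.factorial_succ, Nat.cast_mul, Nat.cast_mul, ih, poch_succ, poch_succ]
    interval_cases ν <;> push_cast <;> ring

/-- The moments of the two-point sphere. -/
lemma hasMoments_point : HasMoments (fun k => if Even k then 1 else 0)
    1 (((0 : ℕ) : ℂ) + ((1 : ℕ) : ℂ) / 2) 0 := by
  refine ⟨fun i => ?_, fun k hk => if_neg ?_⟩
  · have h := factorial_add_two_mul 0 i (ν := 0) (by norm_num)
    have hf : (((2 * i).factorial : ℕ) : ℂ) ≠ 0 := by exact_mod_cast (2 * i).factorial_ne_zero
    simp only [Nat.cast_zero, mul_zero, zero_add, add_zero, Nat.factorial_zero, Nat.cast_one,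
      one_mul, poch_one] at h ⊢
    rw [if_pos (even_two_mul i), ← h, div_self hf]
  · rintro ⟨i, hi⟩
    exact hk i (by omega)

/-! ### Termwise integration -/

/-- Integrated Taylor coefficients, in terms of the moments. -/
def momentCoeff (β : ℂ) (M M' : ℕ → ℂ) (n : ℕ) : ℂ :=
  (n.factorial : ℂ) / 2 ^ n * ∑ a ∈ range (n / 2 + 1), ∑ b ∈ range (n / 2 + 1),
    (hermCoeff n a * 2 ^ (n - 2 * a) * M (n - 2 * a)) *
      (hermCoeff n b * 2 ^ (n - 2 * b) * M' (n - 2 * b)) * poch β (n - a - b)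

lemma momentCoeff_symm (β : ℂ) (M M' : ℕ → ℂ) (n : ℕ) :
    momentCoeff β M M' n = momentCoeff β M' M n := by
  rw [momentCoeff, momentCoeff, sum_comm]
  congr 1
  refine sum_congr rfl fun a _ => sum_congr rfl fun b _ => ?_
  rw [show n - b - a = n - a - b by omega]
  ring

lemma mehlerCoeff_eq_momentCoeff (β x y : ℂ) (n : ℕ) :
    mehlerCoeff β x y n = momentCoeff β (fun k => x ^ k) (fun k => y ^ k) n := by
  simp only [mehlerCoeff_eq, momentCoeff, mul_pow, mul_assoc]

/-- Only the even part of one moment sequence matters if the other one is even. -/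
lemma momentCoeff_even_part (β : ℂ) (M : ℕ → ℂ) {M' : ℕ → ℂ} {K c : ℂ}
    (h : HasMoments M' K c 0) (n : ℕ) :
    momentCoeff β M M' n = momentCoeff β (fun k => if Even k then M k else 0) M' n := by
  rw [momentCoeff, momentCoeff]
  congr 1
  refine sum_congr rfl fun a ha => sum_congr rfl fun b hb => ?_
  rw [mem_range] at ha hb
  -- The exponents n - 2a and n - 2b have the same parity, so an odd one on the left meets a
  -- vanishing moment on the right.
  by_cases hn : Even (n - 2 * a)
  · simp [hn]
  · rw [h.2 (n - 2 * b) fun i hi => hn ?_]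
    · simp
    · exact ⟨i + b - a, by omega⟩

/-- Linearity in the second moment sequence: integration replaces the powers at a point by the
moments. -/
lemma integral_momentCoeff {a b : ℝ} {Y : ℝ → ℝ} {V : ℝ → ℂ} (hY : Continuous Y)
    (hV : Continuous V) (β : ℂ) (M : ℕ → ℂ) (n : ℕ) (z : ℂ) :
    ∫ φ in a..b, momentCoeff β M (fun k => (Y φ : ℂ) ^ k) n * z * V φ =
      momentCoeff β M (fun k => ∫ φ in a..b, (Y φ : ℂ) ^ k * V φ) n * z := by
  have h : ∀ φ : ℝ, momentCoeff β M (fun k => (Y φ : ℂ) ^ k) n * z * V φ =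
      ∑ i ∈ range (n / 2 + 1), ∑ j ∈ range (n / 2 + 1),
        ((n.factorial : ℂ) / 2 ^ n * z * ((hermCoeff n i * 2 ^ (n - 2 * i) * M (n - 2 * i)) *
          (hermCoeff n j * 2 ^ (n - 2 * j)) * poch β (n - i - j))) *
          ((Y φ : ℂ) ^ (n - 2 * j) * V φ) := by
    intro φ
    simp only [momentCoeff, mul_sum, sum_mul]
    refine sum_congr rfl fun a _ => sum_congr rfl fun b _ => ?_
    ring
  simp only [h]
  rw [integral_finsetSum fun i _ => Continuous.intervalIntegrable (by fun_prop) _ _]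
  simp only [momentCoeff, mul_sum, sum_mul]
  refine sum_congr rfl fun i _ => ?_
  rw [integral_finsetSum fun i _ => Continuous.intervalIntegrable (by fun_prop) _ _]
  refine sum_congr rfl fun j _ => ?_
  rw [integral_const_mul]
  ring

lemma continuous_momentCoeff {Y : ℝ → ℝ} (hY : Continuous Y) (β : ℂ) (M : ℕ → ℂ) (n : ℕ) :
    Continuous fun φ => momentCoeff β M (fun k => (Y φ : ℂ) ^ k) n := by
  unfold momentCoeff; fun_prop

lemma hasSum_integral_of_bound {a b : ℝ} {F : ℕ → ℝ → ℂ} {f : ℝ → ℂ} {B : ℕ → ℝ}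
    (hF : ∀ n, Continuous (F n)) (hB : Summable B)
    (hle : ∀ n, ∀ x ∈ Set.uIcc a b, ‖F n x‖ ≤ B n)
    (hs : ∀ x ∈ Set.uIcc a b, HasSum (fun n => F n x) (f x)) :
    HasSum (fun n => ∫ x in a..b, F n x) (∫ x in a..b, f x) :=
  hasSum_integral_of_dominated_convergence (fun n _ => B n)
    (fun n => (hF n).aestronglyMeasurable)
    (fun n => .of_forall fun x hx => hle n x (Set.uIoc_subset_uIcc hx))
    (.of_forall fun _ _ => hB) intervalIntegrable_const
    (.of_forall fun x hx => hs x (Set.uIoc_subset_uIcc hx))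

lemma exists_norm_bound {a b : ℝ} {V : ℝ → ℂ} (hV : Continuous V) :
    ∃ C, 0 ≤ C ∧ ∀ x ∈ Set.uIcc a b, ‖V x‖ ≤ C := by
  obtain ⟨C, hC⟩ := isCompact_uIcc.exists_bound_of_continuousOn hV.continuousOn
  exact ⟨C, (norm_nonneg _).trans (hC a Set.left_mem_uIcc), hC⟩

/-- Termwise integration of the Taylor expansion over one variable, with a uniform bound. -/
lemma hasSum_integral_LamPow {c d : ℝ} {Y : ℝ → ℝ} {V : ℝ → ℂ} (hY : Continuous Y)
    (hV : Continuous V) (hY1 : ∀ φ ∈ Set.uIcc c d, Y φ ^ 2 ≤ 1) (σ : ℂ) (α : ℝ) :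
    (∀ x : ℝ, x ^ 2 ≤ 1 → HasSum (fun n => momentCoeff (-σ / 2) (fun k => (x : ℂ) ^ k)
      (fun k => ∫ φ in c..d, (Y φ : ℂ) ^ k * V φ) n * (Real.tanh α : ℂ) ^ n)
      ((Real.cosh α : ℂ) * ∫ φ in c..d, LamPow σ α x (Y φ) * V φ)) ∧
    ∃ B : ℕ → ℝ, Summable B ∧ ∀ x : ℝ, x ^ 2 ≤ 1 → ∀ n,
      ‖momentCoeff (-σ / 2) (fun k => (x : ℂ) ^ k)
        (fun k => ∫ φ in c..d, (Y φ : ℂ) ^ k * V φ) n * (Real.tanh α : ℂ) ^ n‖ ≤ B n := by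
  obtain ⟨F, hF, hFb⟩ := exists_bound_mehlerCoeff (-σ / 2) (Real.abs_tanh_lt_one α)
  obtain ⟨C, hC0, hC⟩ := exists_norm_bound (a := c) (b := d) hV
  -- The bound is uniform in x too, so that it survives for the second integration.
  have hb : ∀ x : ℝ, x ^ 2 ≤ 1 → ∀ n, ∀ φ ∈ Set.uIcc c d,
      ‖momentCoeff (-σ / 2) (fun k => (x : ℂ) ^ k) (fun k => (Y φ : ℂ) ^ k) n *
        (Real.tanh α : ℂ) ^ n * V φ‖ ≤ F n * C := by
    intro x hx n φ hφ
    rw [norm_mul, ← mehlerCoeff_eq_momentCoeff]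
    have h := hFb x (Y φ) hx (hY1 φ hφ) n
    exact mul_le_mul h (hC φ hφ) (norm_nonneg _) ((norm_nonneg _).trans h)
  refine ⟨fun x hx => ?_, fun n => F n * C * |d - c|, (hF.mul_right _).mul_right _,
    fun x hx n => ?_⟩
  · have h := hasSum_integral_of_bound (a := c) (b := d)
      (F := fun n φ => momentCoeff (-σ / 2) (fun k => (x : ℂ) ^ k) (fun k => (Y φ : ℂ) ^ k) n *
        (Real.tanh α : ℂ) ^ n * V φ)
      (f := fun φ => (Real.cosh α : ℂ) * (LamPow σ α x (Y φ) * V φ))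
      (fun n => ((continuous_momentCoeff hY _ _ n).mul continuous_const).mul hV)
      (hF.mul_right C) (hb x hx) (fun φ hφ => by
        simpa only [← mehlerCoeff_eq_momentCoeff, ← mul_assoc] using
          (hasSum_mehlerCoeff σ α hx (hY1 φ hφ)).mul_right (V φ))
    simpa only [integral_momentCoeff hY hV, integral_const_mul] using h
  · rw [← integral_momentCoeff hY hV]
    exact norm_integral_le_of_norm_le_const fun φ hφ => hb x hx n φ (Set.uIoc_subset_uIcc hφ)

/-- Termwise integration of the Taylor expansion over both variables. -/
lemma hasSum_integral_integral_LamPow {a b c d : ℝ} {X Y : ℝ → ℝ} {W V : ℝ → ℂ}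
    (hX : Continuous X) (hW : Continuous W) (hX1 : ∀ θ ∈ Set.uIcc a b, X θ ^ 2 ≤ 1)
    (hY : Continuous Y) (hV : Continuous V) (hY1 : ∀ φ ∈ Set.uIcc c d, Y φ ^ 2 ≤ 1)
    (σ : ℂ) (α : ℝ) :
    HasSum (fun n => momentCoeff (-σ / 2) (fun k => ∫ θ in a..b, (X θ : ℂ) ^ k * W θ)
      (fun k => ∫ φ in c..d, (Y φ : ℂ) ^ k * V φ) n * (Real.tanh α : ℂ) ^ n)
      ((Real.cosh α : ℂ) * ∫ θ in a..b, ∫ φ in c..d,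
        LamPow σ α (X θ) (Y φ) * (W θ * V φ)) := by
  obtain ⟨hs, B, hB, hle⟩ := hasSum_integral_LamPow hY hV hY1 σ α
  obtain ⟨C, hC0, hC⟩ := exists_norm_bound (a := a) (b := b) hW
  set M' : ℕ → ℂ := fun k => ∫ φ in c..d, (Y φ : ℂ) ^ k * V φ
  -- The moments already computed are moved to the first slot, since `integral_momentCoeff`
  -- integrates in the second one.
  have h := hasSum_integral_of_bound (a := a) (b := b)
    (F := fun n θ => momentCoeff (-σ / 2) M' (fun k => (X θ : ℂ) ^ k) n *
      (Real.tanh α : ℂ) ^ n * W θ)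
    (f := fun θ => (Real.cosh α : ℂ) * ((∫ φ in c..d, LamPow σ α (X θ) (Y φ) * V φ) * W θ))
    (fun n => ((continuous_momentCoeff hX _ _ n).mul continuous_const).mul hW)
    (hB.mul_right C) (fun n θ hθ => by
      rw [norm_mul, momentCoeff_symm]
      have h := hle (X θ) (hX1 θ hθ) n
      exact mul_le_mul h (hC θ hθ) (norm_nonneg _) ((norm_nonneg _).trans h))
    (fun θ hθ => by
      simp only [momentCoeff_symm _ M', ← mul_assoc]
      exact (hs (X θ) (hX1 θ hθ)).mul_right (W θ))
  simp only [integral_momentCoeff hX hW, integral_const_mul] at h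
  simp only [momentCoeff_symm _ M'] at h
  have e : ∫ θ in a..b, ∫ φ in c..d, LamPow σ α (X θ) (Y φ) * (W θ * V φ) =
      ∫ θ in a..b, (∫ φ in c..d, LamPow σ α (X θ) (Y φ) * V φ) * W θ := by
    congr 1
    funext θ
    rw [← integral_mul_const]
    congr 1
    funext φ
    ring
  rw [e]
  exact h

end

end SOpq

/-! ### From integrated coefficients to the Horn series -/

namespace SOpq
open Finset

noncomputable section

/-- The factorial and the power of 4 in the moment cancel against the Hermite coefficient, leaving a
plain alternating hypergeometric sum. -/
lemma sum_hermCoeff_mul_moment {M : ℕ → ℂ} {K c : ℂ} {l : ℕ} (h : HasMoments M K c l) (N : ℕ)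
    (g : ℕ → ℂ) :
    ∑ a ∈ range ((l + 2 * N) / 2 + 1), hermCoeff (l + 2 * N) a * 2 ^ (l + 2 * N - 2 * a) *
        M (l + 2 * N - 2 * a) * g a =
      2 ^ l * K * ∑ ik ∈ antidiagonal N, (-1) ^ ik.2 /
        ((ik.1.factorial : ℂ) * (ik.2.factorial : ℂ) * poch c ik.1) * g ik.2 := by
  have h1 : ∑ a ∈ range ((l + 2 * N) / 2 + 1), hermCoeff (l + 2 * N) a *
      2 ^ (l + 2 * N - 2 * a) * M (l + 2 * N - 2 * a) * g a =
      ∑ a ∈ range (N + 1), hermCoeff (l + 2 * N) a *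
      2 ^ (l + 2 * N - 2 * a) * M (l + 2 * N - 2 * a) * g a := by
    symm
    refine sum_subset (range_subset_range.mpr (by omega)) fun a ha ha' => ?_
    rw [mem_range] at ha ha'
    rw [h.2 _ fun i hi => ha' (by omega)]
    simp
  rw [h1, ← Nat.sum_antidiagonal_eq_sum_range_succ (fun a _ => hermCoeff (l + 2 * N) a *
      2 ^ (l + 2 * N - 2 * a) * M (l + 2 * N - 2 * a) * g a) N, ← Nat.sum_antidiagonal_swap, mul_sum]
  refine sum_congr rfl fun ik hik => ?_
  rw [HasAntidiagonal.mem_antidiagonal] at hik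
  have e : l + 2 * N - 2 * ik.2 = l + 2 * ik.1 := by omega
  have hf : ∀ n : ℕ, (n.factorial : ℂ) ≠ 0 := fun n => by exact_mod_cast n.factorial_ne_zero
  simp only [Prod.fst_swap, hermCoeff, e, h.1, pow_add, pow_mul]
  rw [show (2 : ℂ) ^ 2 = 4 by norm_num]
  have := hf (l + 2 * ik.1)
  have h4 : (4 : ℂ) ^ ik.1 ≠ 0 := pow_ne_zero _ (by norm_num)
  -- If the denominator vanishes, both sides are 0 by the convention x / 0 = 0, so no hypothesis on
  -- c is needed.
  by_cases hp : poch c ik.1 = 0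
  · simp [hp]
  · field_simp

lemma momentCoeff_eq_zero {M M' : ℕ → ℂ} {K c : ℂ} {l : ℕ} (h : HasMoments M K c l) (β : ℂ)
    {n : ℕ} (hn : ∀ N, n ≠ l + 2 * N) : momentCoeff β M M' n = 0 := by
  rw [momentCoeff, sum_eq_zero, mul_zero]
  intro a ha
  refine sum_eq_zero fun b _ => ?_
  rw [mem_range] at ha
  rw [h.2 _ fun i hi => hn (i + a) (by omega)]
  simp

lemma momentCoeff_eq {M M' : ℕ → ℂ} {K K' c d : ℂ} {ν r s : ℕ} (hrs : r ≤ s)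
    (hM : HasMoments M K c (ν + 2 * s)) (hM' : HasMoments M' K' d (ν + 2 * r))
    (hc : ∀ n, poch c n ≠ 0) (hd : ∀ n, poch d n ≠ 0) (β : ℂ) (N : ℕ) :
    momentCoeff β M M' (ν + 2 * s + 2 * N) =
      ((ν + 2 * s + 2 * N).factorial : ℂ) * 2 ^ (ν + 2 * r) / 4 ^ N * K * K' *
        poch β (s + r + ν) *
      ((-1) ^ (s - r) * poch (d - (β + (s + r + ν : ℕ))) (s - r) /
        (((s - r).factorial : ℂ) * poch d (N + (s - r)) * poch c N) *
      ∑ mn ∈ antidiagonal N, poch (β + (s + r + ν : ℕ)) mn.1 *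
        poch (c - (β + (s + r + ν : ℕ))) mn.2 *
        poch (d - (β + (s + r + ν : ℕ)) + (s - r : ℕ)) mn.2 /
        ((mn.1.factorial : ℂ) * (mn.2.factorial : ℂ) * poch (1 + (s - r : ℕ)) mn.2)) := by
  rw [← double_sum_eq _ c d hc hd]
  -- Relative to the lower index r the same degree leaves s - r more steps; this is the δ of
  -- `double_sum_eq`.
  have hn : ν + 2 * s + 2 * N = ν + 2 * r + 2 * (N + (s - r)) := by omega
  have h1 : ∀ a, ∑ b ∈ range ((ν + 2 * s + 2 * N) / 2 + 1),
      (hermCoeff (ν + 2 * s + 2 * N) a * 2 ^ (ν + 2 * s + 2 * N - 2 * a) *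
        M (ν + 2 * s + 2 * N - 2 * a)) *
      (hermCoeff (ν + 2 * s + 2 * N) b * 2 ^ (ν + 2 * s + 2 * N - 2 * b) *
        M' (ν + 2 * s + 2 * N - 2 * b)) * poch β (ν + 2 * s + 2 * N - a - b) =
      hermCoeff (ν + 2 * s + 2 * N) a * 2 ^ (ν + 2 * s + 2 * N - 2 * a) *
        M (ν + 2 * s + 2 * N - 2 * a) * (2 ^ (ν + 2 * r) * K' *
        ∑ jl ∈ antidiagonal (N + (s - r)), (-1) ^ jl.2 /
        ((jl.1.factorial : ℂ) * (jl.2.factorial : ℂ) * poch d jl.1) *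
          poch β (ν + 2 * s + 2 * N - a - jl.2)) := by
    intro a
    rw [← sum_hermCoeff_mul_moment hM' (N + (s - r))
      (fun b => poch β (ν + 2 * s + 2 * N - a - b)), mul_sum, ← hn]
    refine sum_congr rfl fun b _ => ?_
    ring
  rw [momentCoeff, sum_congr rfl fun a _ => h1 a, sum_hermCoeff_mul_moment hM N
    (fun a => 2 ^ (ν + 2 * r) * K' * ∑ jl ∈ antidiagonal (N + (s - r)), (-1) ^ jl.2 /
        ((jl.1.factorial : ℂ) * (jl.2.factorial : ℂ) * poch d jl.1) *
          poch β (ν + 2 * s + 2 * N - a - jl.2))]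
  simp only [mul_sum]
  refine sum_congr rfl fun ik hik => sum_congr rfl fun jl hjl => ?_
  rw [HasAntidiagonal.mem_antidiagonal] at hik hjl
  -- In the complementary indices the Pochhammer length is a constant plus i + j, so (β)_(s+r+ν)
  -- factors out and the parameter a = β + s + r + ν appears.
  rw [show ν + 2 * s + 2 * N - ik.2 - jl.2 = s + r + ν + (ik.1 + jl.1) by omega, poch_add β,
    show (2 : ℂ) ^ (ν + 2 * s + 2 * N) = 2 ^ (ν + 2 * s) * 4 ^ N by
      rw [pow_add _ _ (2 * N), pow_mul _ 2 N]; norm_num, pow_add (-1 : ℂ) ik.2]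
  have h4 : (4 : ℂ) ^ N ≠ 0 := pow_ne_zero _ (by norm_num)
  have h2 : (2 : ℂ) ^ (ν + 2 * s) ≠ 0 := pow_ne_zero _ (by norm_num)
  have := hc ik.1
  have := hd jl.1
  field_simp

/-- Since (1+k)_n ≥ n!, the terms are dominated by the diagonal of the product of two binomial
series at √T. -/
lemma summable_poch_mul_poch (a b : ℂ) (k : ℕ) {T : ℝ} (h0 : 0 ≤ T) (hT : T < 1) :
    Summable fun n : ℕ => ‖poch a n * poch b n / (poch (1 + k) n * (n.factorial : ℂ))‖ * T ^ n := by
  have hS1 : √T < 1 := by rw [Real.sqrt_lt' one_pos]; simpa using hT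
  have h := ((summable_norm_poch_div a (Real.sqrt_nonneg T) hS1).mul_of_nonneg
    (summable_norm_poch_div b (Real.sqrt_nonneg T) hS1) (fun _ => by positivity)
    (fun _ => by positivity)).comp_injective (i := fun n : ℕ => (n, n))
    (fun _ _ h => congrArg Prod.fst h)
  refine h.of_nonneg_of_le (fun n => by positivity) fun n => ?_
  have hT' : T ^ n = √T ^ n * √T ^ n := by rw [← mul_pow, Real.mul_self_sqrt h0]
  have hk : (n.factorial : ℝ) ≤ ‖poch (1 + (k : ℂ)) n‖ := by
    have h1 := congrArg norm (factorial_mul_poch k n)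
    have h2 := Nat.le_of_dvd (Nat.factorial_pos _) (Nat.factorial_mul_factorial_dvd_factorial_add k n)
    have h3 : (k.factorial : ℝ) * n.factorial ≤ ((k + n).factorial : ℝ) := by exact_mod_cast h2
    rw [norm_mul, Complex.norm_natCast, Complex.norm_natCast] at h1
    rw [← h1, add_comm (k : ℂ)] at h3
    exact le_of_mul_le_mul_left h3 (by exact_mod_cast k.factorial_pos)
  have hn : (0 : ℝ) < n.factorial := by exact_mod_cast n.factorial_pos
  simp only [Function.comp, norm_div, norm_mul, Complex.norm_natCast, hT']
  calc _ ≤ ‖poch a n‖ * ‖poch b n‖ / ((n.factorial : ℝ) * n.factorial) * (√T ^ n * √T ^ n) := by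
        gcongr
    _ = _ := by field_simp

lemma norm_poch_le_norm_poch {x c : ℝ} (hx : 0 ≤ x) (hc : x ≤ c) (n : ℕ) :
    ‖poch (x : ℂ) n‖ ≤ ‖poch (c : ℂ) n‖ := by
  induction n with
  | zero => simp
  | succ n ih =>
    rw [poch_succ, poch_succ, norm_mul, norm_mul]
    gcongr
    rw [← Complex.ofReal_natCast, ← Complex.ofReal_add, ← Complex.ofReal_add, Complex.norm_real,
      Complex.norm_real, Real.norm_of_nonneg (by positivity),
      Real.norm_of_nonneg (by linarith [Nat.cast_nonneg (α := ℝ) n])]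
    linarith

/-- The Horn term in closed form. -/
lemma hornTerm_eq (p q ν : ℕ) (σ : ℂ) {r s : ℕ} (hrs : r ≤ s) (α : ℝ) (n : Fin 2 → ℕ) :
    hornTerm u5 (assocNum p q ν σ r s) v3 (assocDen p q ν r s) (tanhSq α) n =
      poch ((s : ℂ) + 1) (n 0 + n 1) * poch ((s : ℂ) + ν + 1 / 2) (n 0 + n 1) /
        (poch (2 * (s : ℂ) + ν + (p : ℂ) / 2) (n 0 + n 1) *
          poch ((s : ℂ) + r + ν + (q : ℂ) / 2) (n 0 + n 1)) *
      (poch ((s : ℂ) + r + ν - σ / 2) (n 0) / ((n 0).factorial : ℂ)) *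
      (poch (((q : ℂ) + σ) / 2) (n 1) * poch ((s : ℂ) - r + ((p : ℂ) + σ) / 2) (n 1) /
        (poch (1 + (s - r : ℕ)) (n 1) * ((n 1).factorial : ℂ))) *
      ((Real.tanh α : ℂ) ^ 2) ^ (n 0 + n 1) := by
  simp only [hornTerm, u5, v3, assocNum, assocDen, tanhSq, Fin.prod_univ_succ, Fin.sum_univ_succ,
    Nat.cast_sub hrs]
  simp
  rw [pow_add, show 1 + ((s : ℂ) - r) = 1 + s - r by ring]
  ring

lemma summable_hornTerm {p q : ℕ} (hp : 2 ≤ p) (hq : 1 ≤ q) (ν : ℕ) (σ : ℂ) {r s : ℕ}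
    (hrs : r ≤ s) (α : ℝ) :
    Summable (hornTerm u5 (assocNum p q ν σ r s) v3 (assocDen p q ν r s) (tanhSq α)) := by
  have hT : Real.tanh α ^ 2 < 1 := by
    rw [sq_lt_one_iff_abs_lt_one]; exact Real.abs_tanh_lt_one α
  have hp' : (2 : ℝ) ≤ p := by exact_mod_cast hp
  have hq' : (1 : ℝ) ≤ q := by exact_mod_cast hq
  have h := (summable_norm_poch_div ((s : ℂ) + r + ν - σ / 2) (sq_nonneg (Real.tanh α))
    hT).mul_of_nonneg (summable_poch_mul_poch (((q : ℂ) + σ) / 2)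
      ((s : ℂ) - r + ((p : ℂ) + σ) / 2) (s - r) (sq_nonneg (Real.tanh α)) hT)
    (fun _ => by positivity) (fun _ => by positivity)
  have h' := h.comp_injective (i := finTwoArrowEquiv ℕ) (finTwoArrowEquiv ℕ).injective
  refine Summable.of_norm (h'.of_nonneg_of_le (fun _ => norm_nonneg _) fun n => ?_)
  rw [hornTerm_eq p q ν σ hrs]
  -- The coupled parameters compare as s + 1 ≤ 2s + ν + p/2 and s + ν + 1/2 ≤ s + r + ν + q/2, by p
  -- ≥ 2 and q ≥ 1. Their quotient is at most 1, and a product of one-variable series remains.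
  have b1 := norm_poch_le_norm_poch (x := (s : ℝ) + 1) (c := 2 * (s : ℝ) + ν + (p : ℝ) / 2)
    (by positivity) (by nlinarith [Nat.cast_nonneg (α := ℝ) s, Nat.cast_nonneg (α := ℝ) ν])
    (n 0 + n 1)
  have b2 := norm_poch_le_norm_poch (x := (s : ℝ) + ν + 1 / 2)
    (c := (s : ℝ) + r + ν + (q : ℝ) / 2)
    (by positivity) (by nlinarith [Nat.cast_nonneg (α := ℝ) r]) (n 0 + n 1)
  push_cast at b1 b2
  have b3 : ‖poch ((s : ℂ) + 1) (n 0 + n 1) * poch ((s : ℂ) + ν + 1 / 2) (n 0 + n 1) /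
        (poch (2 * (s : ℂ) + ν + (p : ℂ) / 2) (n 0 + n 1) *
          poch ((s : ℂ) + r + ν + (q : ℂ) / 2) (n 0 + n 1))‖ ≤ 1 := by
    rw [norm_div, norm_mul, norm_mul]
    exact div_le_one_of_le₀ (mul_le_mul b1 b2 (norm_nonneg _) (norm_nonneg _)) (by positivity)
  rw [norm_mul, norm_mul, norm_mul, norm_pow, norm_pow, Complex.norm_real, Real.norm_eq_abs, sq_abs]
  have hn : finTwoArrowEquiv ℕ n = (n 0, n 1) := rfl
  simp only [Function.comp, hn]
  calc _ ≤ 1 * ‖poch ((s : ℂ) + r + ν - σ / 2) (n 0) / ((n 0).factorial : ℂ)‖ *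
        ‖poch (((q : ℂ) + σ) / 2) (n 1) * poch ((s : ℂ) - r + ((p : ℂ) + σ) / 2) (n 1) /
        (poch (1 + (s - r : ℕ)) (n 1) * ((n 1).factorial : ℂ))‖ *
        (Real.tanh α ^ 2) ^ (n 0 + n 1) := by gcongr
    _ = _ := by rw [pow_add]; ring

/-- The Horn series, summed along antidiagonals. -/
lemma hasSum_hornSeries {p q : ℕ} (hp : 2 ≤ p) (hq : 1 ≤ q) (ν : ℕ) (σ : ℂ) {r s : ℕ}
    (hrs : r ≤ s) (α : ℝ) :
    HasSum (fun N => ∑ mn ∈ antidiagonal N,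
      hornTerm u5 (assocNum p q ν σ r s) v3 (assocDen p q ν r s) (tanhSq α) ![mn.1, mn.2])
      (hornSeries u5 (assocNum p q ν σ r s) v3 (assocDen p q ν r s) (tanhSq α)) := by
  have h := (summable_hornTerm hp hq ν σ hrs α).hasSum
  rw [← (finTwoArrowEquiv ℕ).symm.hasSum_iff,
    ← (HasAntidiagonal.sigmaAntidiagonalEquivProd (A := ℕ)).hasSum_iff] at h
  have h2 := h.sigma fun N => hasSum_fintype _
  rw [hornSeries]
  convert h2 using 2 with N
  rw [← sum_coe_sort (antidiagonal N)]
  rfl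

/-- The dictionary is a = s + r + ν - σ/2, c = 2s + ν + p/2, d = 2r + ν + q/2, δ = s - r; hence c -
a = s - r + (p+σ)/2, d - a + δ = (q+σ)/2 and d + δ = s + r + ν + q/2. -/
lemma momentCoeff_mul_pow_eq {p q ν r s : ℕ} (hp : 2 ≤ p) (hq : 1 ≤ q) (hν : ν ≤ 1)
    (hrs : r ≤ s) {M M' : ℕ → ℂ} {K K' : ℂ}
    (hM : HasMoments M K (((ν + 2 * s : ℕ) : ℂ) + (p : ℂ) / 2) (ν + 2 * s))
    (hM' : HasMoments M' K' (((ν + 2 * r : ℕ) : ℂ) + (q : ℂ) / 2) (ν + 2 * r))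
    (σ : ℂ) (α : ℝ) (N : ℕ) :
    momentCoeff (-σ / 2) M M' (ν + 2 * s + 2 * N) * (Real.tanh α : ℂ) ^ (ν + 2 * s + 2 * N) =
      ((2 * s + ν).factorial : ℂ) * poch ((2 - σ - q) / 2) (s - r) /
      (((s - r).factorial : ℂ) * poch (2 * (r : ℂ) + ν + (q : ℂ) / 2) (s - r)) *
      poch (-σ / 2) (s + r + ν) * (K * (2 ^ (ν + 2 * r) * K')) *
      (Real.tanh α : ℂ) ^ (2 * s + ν) * ∑ mn ∈ antidiagonal N,
      hornTerm u5 (assocNum p q ν σ r s) v3 (assocDen p q ν r s) (tanhSq α) ![mn.1, mn.2] := by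
  have hp' : (2 : ℝ) ≤ p := by exact_mod_cast hp
  have hq' : (1 : ℝ) ≤ q := by exact_mod_cast hq
  have hsr : ((s - r : ℕ) : ℂ) = s - r := Nat.cast_sub hrs
  have ea : -σ / 2 + ((s + r + ν : ℕ) : ℂ) = (s : ℂ) + r + ν - σ / 2 := by push_cast; ring
  have ec : ((ν + 2 * s : ℕ) : ℂ) + (p : ℂ) / 2 = 2 * (s : ℂ) + ν + (p : ℂ) / 2 := by
    push_cast; ring
  have ed : ((ν + 2 * r : ℕ) : ℂ) + (q : ℂ) / 2 = 2 * (r : ℂ) + ν + (q : ℂ) / 2 := by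
    push_cast; ring
  rw [ec] at hM
  rw [ed] at hM'
  have hc : ∀ n, poch (2 * (s : ℂ) + ν + (p : ℂ) / 2) n ≠ 0 := fun n => by
    have := poch_ofReal_ne_zero (a := 2 * (s : ℝ) + ν + (p : ℝ) / 2) (by positivity) n
    push_cast at this; exact this
  have hd : ∀ n, poch (2 * (r : ℂ) + ν + (q : ℂ) / 2) n ≠ 0 := fun n => by
    have := poch_ofReal_ne_zero (a := 2 * (r : ℝ) + ν + (q : ℝ) / 2) (by positivity) n
    push_cast at this; exact this
  have hfac : ((ν + 2 * s + 2 * N).factorial : ℂ) * 2 ^ (ν + 2 * r) / 4 ^ N =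
      ((2 * s + ν).factorial : ℂ) * poch ((s : ℂ) + 1) N * poch ((s : ℂ) + ν + 1 / 2) N *
        2 ^ (ν + 2 * r) := by
    have h4 : (4 : ℂ) ^ N ≠ 0 := pow_ne_zero _ (by norm_num)
    rw [add_comm ν (2 * s), factorial_add_two_mul s N hν]
    field_simp
  rw [momentCoeff_eq hrs hM hM' hc hd, hfac, ea,
    show ν + 2 * s + 2 * N = 2 * s + ν + 2 * N by ring, pow_add _ (2 * s + ν) (2 * N),
    pow_mul _ 2 N]
  generalize ha : (s : ℂ) + r + ν - σ / 2 = a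
  have ed' : (s : ℂ) + r + ν + (q : ℂ) / 2 = 2 * (r : ℂ) + ν + (q : ℂ) / 2 + (s - r : ℕ) := by
    rw [hsr]; ring
  have e1 : (s : ℂ) - r + ((p : ℂ) + σ) / 2 = 2 * (s : ℂ) + ν + (p : ℂ) / 2 - a := by
    rw [← ha]; ring
  have e2 : ((q : ℂ) + σ) / 2 = 2 * (r : ℂ) + ν + (q : ℂ) / 2 - a + (s - r : ℕ) := by
    rw [← ha, hsr]; ring
  have e3 : (2 - σ - (q : ℂ)) / 2 =
      1 - (2 * (r : ℂ) + ν + (q : ℂ) / 2 - a) - (s - r : ℕ) := by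
    rw [← ha, hsr]; ring
  -- Reflection absorbs the sign: ((2-σ-q)/2)_δ = (-1)^δ (d-a)_δ.
  rw [e3, poch_one_sub, mul_sum, mul_sum, mul_sum, sum_mul]
  refine sum_congr rfl fun mn hmn => ?_
  rw [HasAntidiagonal.mem_antidiagonal] at hmn
  rw [hornTerm_eq p q ν σ hrs, ha, ed', e1, e2]
  simp only [Matrix.cons_val_zero, Matrix.cons_val_one]
  rw [hmn]
  generalize 2 * (s : ℂ) + ν + (p : ℂ) / 2 = c at *
  generalize 2 * (r : ℂ) + ν + (q : ℂ) / 2 = d at *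
  have edN : poch d (N + (s - r)) = poch d (s - r) * poch (d + (s - r : ℕ)) N := by
    rw [add_comm N, poch_add]
  rw [edN]
  ring

/-- Stated for abstract moment sequences, so that all pairs of spheres, including the two-point
sphere for q = 1, are covered by one argument. -/
theorem eq_hornSeries_of_hasSum {p q ν r s : ℕ} (hp : 2 ≤ p) (hq : 1 ≤ q) (hν : ν ≤ 1)
    (hrs : r ≤ s) {M M' : ℕ → ℂ} {K K' T : ℂ}
    (hM : HasMoments M K (((ν + 2 * s : ℕ) : ℂ) + (p : ℂ) / 2) (ν + 2 * s))
    (hM' : HasMoments M' K' (((ν + 2 * r : ℕ) : ℂ) + (q : ℂ) / 2) (ν + 2 * r))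
    (σ : ℂ) (α : ℝ)
    (hT : HasSum (fun n => momentCoeff (-σ / 2) M M' n * (Real.tanh α : ℂ) ^ n) T) :
    T = ((2 * s + ν).factorial : ℂ) * poch ((2 - σ - q) / 2) (s - r) /
      (((s - r).factorial : ℂ) * poch (2 * (r : ℂ) + ν + (q : ℂ) / 2) (s - r)) *
      poch (-σ / 2) (s + r + ν) * (K * (2 ^ (ν + 2 * r) * K')) *
      (Real.tanh α : ℂ) ^ (2 * s + ν) *
      hornSeries u5 (assocNum p q ν σ r s) v3 (assocDen p q ν r s) (tanhSq α) := by
  have hinj : Function.Injective fun N => ν + 2 * s + 2 * N := fun a b h => by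
    simp only at h; omega
  rw [← hinj.hasSum_iff] at hT
  swap
  · intro n hn
    rw [momentCoeff_eq_zero hM _ fun N hN => hn ⟨N, hN.symm⟩, zero_mul]
  simp only [Function.comp_def, momentCoeff_mul_pow_eq hp hq hν hrs hM hM'] at hT
  exact hT.unique ((hasSum_hornSeries hp hq ν σ hrs α).mul_left _)

end

end SOpq

/-! ### Normalization constants -/

namespace SOpq
open Finset

noncomputable section

/-- The normalization factor that belongs to one of the two spheres. -/
def sphereNorm (n l : ℕ) : ℝ :=
  if n = 2 then 1 / (2 * Real.pi) else
    Real.Gamma (((n : ℝ) - 2) / 2) *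
      √((2 : ℝ) ^ ((n : ℝ) - 4) * Real.Gamma ((n : ℝ) / 2) * (l.factorial : ℝ) *
          (2 * (l : ℝ) + n - 2) /
        (Real.pi ^ ((3 : ℝ) / 2) * Real.Gamma (((n : ℝ) - 1) / 2) * Real.Gamma ((l : ℝ) + n - 2)))

lemma pi_rpow_three_half : Real.pi ^ ((3 : ℝ) / 2) = √Real.pi ^ 3 := by
  rw [Real.sqrt_eq_rpow, ← Real.rpow_mul_natCast Real.pi_pos.le]; norm_num

lemma aTwo_eq {p q : ℕ} (hp : 3 ≤ p) (hq : 3 ≤ q) (lam mu : ℕ) :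
    aTwo p q lam mu = sphereNorm p mu * sphereNorm q lam := by
  have hp' : (3 : ℝ) ≤ p := by exact_mod_cast hp
  have hq' : (3 : ℝ) ≤ q := by exact_mod_cast hq
  have g1 := Real.Gamma_pos_of_pos (s := (p : ℝ) / 2) (by linarith)
  have g2 := Real.Gamma_pos_of_pos (s := (q : ℝ) / 2) (by linarith)
  have g3 := Real.Gamma_pos_of_pos (s := ((p : ℝ) - 1) / 2) (by linarith)
  have g4 := Real.Gamma_pos_of_pos (s := ((q : ℝ) - 1) / 2) (by linarith)
  have hl : (0 : ℝ) ≤ lam := Nat.cast_nonneg _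
  have hm : (0 : ℝ) ≤ mu := Nat.cast_nonneg _
  have g5 := Real.Gamma_pos_of_pos (s := (lam : ℝ) + q - 2) (by linarith)
  have g6 := Real.Gamma_pos_of_pos (s := (mu : ℝ) + p - 2) (by linarith)
  have h1 : 0 < 2 * (mu : ℝ) + p - 2 := by linarith
  have h2 : 0 < 2 * (lam : ℝ) + q - 2 := by linarith
  have hw : (2 : ℝ) ^ ((p : ℝ) + q - 8) = 2 ^ ((p : ℝ) - 4) * 2 ^ ((q : ℝ) - 4) := by
    rw [← Real.rpow_add (by norm_num)]; congr 1; ring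
  have hpi : Real.pi ^ 3 = √Real.pi ^ 3 * √Real.pi ^ 3 := by
    rw [← mul_pow, Real.mul_self_sqrt Real.pi_pos.le]
  have he : 0 < √Real.pi := Real.sqrt_pos.mpr Real.pi_pos
  have w1 : (0 : ℝ) < 2 ^ ((p : ℝ) - 4) := by positivity
  have w2 : (0 : ℝ) < 2 ^ ((q : ℝ) - 4) := by positivity
  rw [aTwo, sphereNorm, sphereNorm, if_neg (by omega), if_neg (by omega), mul_assoc,
    ← Real.sqrt_mul (by positivity), mul_mul_mul_comm, ← Real.sqrt_mul (by positivity),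
    pi_rpow_three_half, hw, hpi]
  congr 2
  field_simp

lemma aOne_eq {p : ℕ} (hp : 3 ≤ p) (mu : ℕ) :
    aOne p mu = sphereNorm p mu * (1 / (2 * Real.pi)) := by
  have hw : (2 : ℝ) ^ ((p : ℝ) - 6) = 2 ^ ((p : ℝ) - 4) / 4 := by
    rw [show (p : ℝ) - 6 = (p : ℝ) - 4 - 2 by ring, Real.rpow_sub (by norm_num)]; norm_num
  have hpi : Real.pi ^ ((7 : ℝ) / 2) = Real.pi ^ ((3 : ℝ) / 2) * Real.pi ^ 2 := by
    rw [← Real.rpow_natCast, ← Real.rpow_add Real.pi_pos]; norm_num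
  have h2 : (1 / (2 * Real.pi)) = √((1 / (2 * Real.pi)) ^ 2) :=
    (Real.sqrt_sq (by positivity)).symm
  rw [aOne, sphereNorm, if_neg (by omega), h2, mul_assoc (Real.Gamma (((p : ℝ) - 2) / 2)),
    ← Real.sqrt_mul' _ (by positivity),
    hw, hpi]
  congr 2
  field_simp
  norm_num

lemma Gamma_add_natCast {a : ℝ} (ha : 0 < a) (l : ℕ) :
    Real.Gamma (a + l) = (ascPochhammer ℝ l).eval a * Real.Gamma a := by
  induction l with
  | zero => simp
  | succ l ih =>
    rw [Nat.cast_succ, ← add_assoc, Real.Gamma_add_one (by positivity), ih,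
      ascPochhammer_succ_eval]
    ring

lemma Gamma_duplication (n : ℕ) :
    Real.Gamma (((n : ℝ) - 2) / 2) * Real.Gamma (((n : ℝ) - 1) / 2) =
      Real.Gamma ((n : ℝ) - 2) * (8 / 2 ^ n) * √Real.pi := by
  have h := Real.Gamma_mul_Gamma_add_half (((n : ℝ) - 2) / 2)
  rw [show ((n : ℝ) - 2) / 2 + 1 / 2 = ((n : ℝ) - 1) / 2 by ring,
    show 2 * (((n : ℝ) - 2) / 2) = (n : ℝ) - 2 by ring] at h
  rw [h, show 1 - ((n : ℝ) - 2) = 3 - n by ring, Real.rpow_sub (by norm_num), Real.rpow_natCast]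
  norm_num

lemma gegenbauerConst_eq {n : ℕ} (hn : 3 ≤ n) (l : ℕ) :
    gegenbauerConst (((n : ℝ) - 2) / 2) l = √Real.pi * Real.Gamma (((n : ℝ) - 1) / 2) *
      Real.Gamma ((l : ℝ) + n - 2) / (Real.Gamma ((n : ℝ) - 2) * 2 ^ l * (l.factorial : ℝ) *
        Real.Gamma ((l : ℝ) + (n : ℝ) / 2)) := by
  obtain ⟨m, rfl⟩ := Nat.exists_eq_add_of_le hn
  have hm : (0 : ℝ) ≤ m := Nat.cast_nonneg _
  have hJ := weightMoment_zero m
  push_cast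
  rw [gegenbauerConst, show (3 + (m : ℝ) - 2) / 2 - 1 / 2 = (m : ℝ) / 2 by ring, hJ,
    show (l : ℝ) + (3 + m) - 2 = (1 + (m : ℝ)) + l by ring,
    Gamma_add_natCast (a := 1 + (m : ℝ)) (by positivity),
    show (l : ℝ) + (3 + (m : ℝ)) / 2 = ((m : ℝ) / 2 + 3 / 2) + l by ring,
    Gamma_add_natCast (a := (m : ℝ) / 2 + 3 / 2) (by positivity),
    show 2 * ((3 + (m : ℝ) - 2) / 2) = 1 + m by ring,
    show (3 + (m : ℝ) - 2) / 2 + 1 = (m : ℝ) / 2 + 3 / 2 by ring,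
    show 3 + (m : ℝ) - 2 = 1 + m by ring, show (3 + (m : ℝ) - 1) / 2 = (m : ℝ) / 2 + 1 by ring]
  have g1 := (Real.Gamma_pos_of_pos (s := 1 + (m : ℝ)) (by positivity)).ne'
  have g2 := (ascPochhammer_pos l ((m : ℝ) / 2 + 3 / 2) (by positivity)).ne'
  generalize (ascPochhammer ℝ l).eval ((m : ℝ) / 2 + 3 / 2) = x at *
  generalize Real.Gamma ((m : ℝ) / 2 + 3 / 2) = y at *
  generalize Real.Gamma (1 + (m : ℝ)) = z at *
  field_simp

/-- The ratio between the moments on one of the two spheres and their standard form. -/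
def sphereConst (n l : ℕ) : ℝ :=
  if n = 2 then 2 * Real.pi / (2 ^ l * (l.factorial : ℝ))
  else gegenbauerConst (((n : ℝ) - 2) / 2) l

lemma sphereNorm_zero {n : ℕ} (hn : 3 ≤ n) : sphereNorm n 0 =
    Real.Gamma ((n : ℝ) / 2) / (√Real.pi * Real.Gamma (((n : ℝ) - 1) / 2)) := by
  have hn' : (3 : ℝ) ≤ n := by exact_mod_cast hn
  have g1 := Real.Gamma_pos_of_pos (s := ((n : ℝ) - 2) / 2) (by linarith)
  have g2 := Real.Gamma_pos_of_pos (s := ((n : ℝ) - 1) / 2) (by linarith)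
  have g3 := Real.Gamma_pos_of_pos (s := (n : ℝ) / 2) (by linarith)
  have g4 := Real.Gamma_pos_of_pos (s := (n : ℝ) - 2) (by linarith)
  have hG : Real.Gamma ((n : ℝ) / 2) = ((n : ℝ) - 2) / 2 * Real.Gamma (((n : ℝ) - 2) / 2) := by
    rw [← Real.Gamma_add_one (by linarith)]; congr 1; ring
  have hdup := Gamma_duplication n
  have he : 0 < √Real.pi := Real.sqrt_pos.mpr Real.pi_pos
  have hw : (2 : ℝ) ^ ((n : ℝ) - 4) = 2 ^ n / 16 := by
    rw [Real.rpow_sub (by norm_num), Real.rpow_natCast]; norm_num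
  have hn2 : 0 < (n : ℝ) - 2 := by linarith
  rw [sphereNorm, if_neg (by omega), ← sq_eq_sq₀ (by positivity) (by positivity), mul_pow,
    Real.sq_sqrt (by simp only [Nat.cast_zero, mul_zero, zero_add]; positivity),
    pi_rpow_three_half, hw]
  simp only [Nat.cast_zero, mul_zero, zero_add, Nat.factorial_zero, Nat.cast_one, mul_one]
  have hw2 : (0 : ℝ) < 2 ^ n := by positivity
  have hg : Real.Gamma ((n : ℝ) - 2) = Real.Gamma (((n : ℝ) - 2) / 2) *
      Real.Gamma (((n : ℝ) - 1) / 2) * 2 ^ n / (8 * √Real.pi) := by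
    rw [hdup]; field_simp
  rw [hg]
  generalize Real.Gamma (((n : ℝ) - 2) / 2) = x at *
  generalize Real.Gamma (((n : ℝ) - 1) / 2) = y at *
  generalize Real.Gamma ((n : ℝ) / 2) = z at *
  generalize √Real.pi = e at *
  subst hG
  field_simp
  ring

/-- For l = 0 the normalized integral is the mean over the sphere, and the mean of 1 is 1. -/
lemma sphereNorm_mul_sphereConst_zero {n : ℕ} (hn : 2 ≤ n) :
    sphereNorm n 0 * sphereConst n 0 = 1 := by
  rcases hn.eq_or_lt with rfl | hn
  · simp [sphereNorm, sphereConst]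
    field_simp
  · have hn' : (3 : ℝ) ≤ n := by exact_mod_cast hn
    have g2 := Real.Gamma_pos_of_pos (s := ((n : ℝ) - 1) / 2) (by linarith)
    have g3 := Real.Gamma_pos_of_pos (s := (n : ℝ) / 2) (by linarith)
    have g4 := Real.Gamma_pos_of_pos (s := (n : ℝ) - 2) (by linarith)
    rw [sphereNorm_zero hn, sphereConst, if_neg (by omega), gegenbauerConst_eq hn]
    simp only [Nat.cast_zero, zero_add, pow_zero, Nat.factorial_zero, Nat.cast_one, mul_one]
    field_simp

/-- The share of one sphere in the product of A₁ and A₂. For n ≥ 3 both sides are positive, so their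
squares are compared; the duplication formula eliminates Γ(n-2). -/
lemma sphereNorm_mul_sphereConst {n : ℕ} (hn : 2 ≤ n) (l : ℕ) :
    sphereNorm n l * sphereConst n l * 2 ^ l =
      2 ^ ((3 - (n : ℝ)) / 2) / Real.Gamma ((l : ℝ) + (n : ℝ) / 2) *
      √(√Real.pi * Real.Gamma ((n : ℝ) / 2) / Real.Gamma (((n : ℝ) - 1) / 2)) *
      √(Real.Gamma ((l : ℝ) + n - 1) / (l.factorial : ℝ)) * √(normRatio n l) := by
  have he : 0 < √Real.pi := Real.sqrt_pos.mpr Real.pi_pos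
  have hl : (0 : ℝ) ≤ l := Nat.cast_nonneg _
  rcases hn.eq_or_lt with rfl | hn
  · have hf : (0 : ℝ) < l.factorial := by exact_mod_cast l.factorial_pos
    simp only [sphereNorm, sphereConst, normRatio, if_true, Nat.cast_ofNat]
    rw [show (l : ℝ) + 2 / 2 = l + 1 by norm_num, show (l : ℝ) + 2 - 1 = l + 1 by ring,
      Real.Gamma_nat_eq_factorial, show ((2 : ℝ) - 1) / 2 = 1 / 2 by norm_num,
      Real.Gamma_one_half_eq, show (2 : ℝ) / 2 = 1 by norm_num, Real.Gamma_one, mul_one,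
      div_self he.ne', div_self hf.ne', show ((3 : ℝ) - 2) / 2 = 1 / 2 by norm_num,
      ← Real.sqrt_eq_rpow, Real.sqrt_one, mul_one, mul_one]
    have h2 : √(2 : ℝ) * √(1 / 2) = 1 := by
      rw [← Real.sqrt_mul (by norm_num)]; norm_num
    have h3 : √(2 : ℝ) / l.factorial * √(1 / 2) = 1 / l.factorial := by
      rw [div_mul_eq_mul_div, h2]
    rw [h3]
    field_simp
  · have hn' : (3 : ℝ) ≤ n := by exact_mod_cast hn
    have g1 := Real.Gamma_pos_of_pos (s := ((n : ℝ) - 2) / 2) (by linarith)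
    have g2 := Real.Gamma_pos_of_pos (s := ((n : ℝ) - 1) / 2) (by linarith)
    have g3 := Real.Gamma_pos_of_pos (s := (n : ℝ) / 2) (by linarith)
    have g4 := Real.Gamma_pos_of_pos (s := (n : ℝ) - 2) (by linarith)
    have g5 := Real.Gamma_pos_of_pos (s := (l : ℝ) + n - 2) (by linarith)
    have g6 := Real.Gamma_pos_of_pos (s := (l : ℝ) + (n : ℝ) / 2) (by linarith)
    have hG : Real.Gamma ((l : ℝ) + n - 1) = ((l : ℝ) + n - 2) * Real.Gamma ((l : ℝ) + n - 2) := by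
      rw [← Real.Gamma_add_one (by linarith)]; congr 1; ring
    have hf : (0 : ℝ) < l.factorial := by exact_mod_cast l.factorial_pos
    have h1 : 0 < 2 * (l : ℝ) + n - 2 := by linarith
    have h2 : 0 < (l : ℝ) + n - 2 := by linarith
    have h3 : 0 < (l : ℝ) + ((n : ℝ) - 2) / 2 := by linarith
    have hdup := Gamma_duplication n
    have hw : (2 : ℝ) ^ ((n : ℝ) - 4) = 2 ^ n / 16 := by
      rw [Real.rpow_sub (by norm_num), Real.rpow_natCast]; norm_num
    have hw' : ((2 : ℝ) ^ ((3 - (n : ℝ)) / 2)) ^ 2 = 8 / 2 ^ n := by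
      rw [← Real.rpow_mul_natCast (by norm_num), show (3 - (n : ℝ)) / 2 * (2 : ℕ) = 3 - n by
        push_cast; ring, Real.rpow_sub (by norm_num), Real.rpow_natCast]
      norm_num
    have hw2 : (0 : ℝ) < 2 ^ n := by positivity
    have hg : Real.Gamma ((n : ℝ) - 2) = Real.Gamma (((n : ℝ) - 2) / 2) *
        Real.Gamma (((n : ℝ) - 1) / 2) * 2 ^ n / (8 * √Real.pi) := by
      rw [hdup]; field_simp
    rw [sphereNorm, sphereConst, normRatio, if_neg (by omega), if_neg (by omega),
      if_neg (by omega), gegenbauerConst_eq hn, ← sq_eq_sq₀ (by positivity) (by positivity),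
      pi_rpow_three_half, hw, hG, hg]
    generalize √Real.pi = e at *
    simp only [mul_pow, div_pow]
    rw [Real.sq_sqrt (by positivity), Real.sq_sqrt (by positivity), Real.sq_sqrt (by positivity),
      Real.sq_sqrt (by positivity), hw']
    generalize Real.Gamma (((n : ℝ) - 2) / 2) = x at *
    generalize Real.Gamma (((n : ℝ) - 1) / 2) = y at *
    generalize Real.Gamma ((n : ℝ) / 2) = z at *
    generalize Real.Gamma ((l : ℝ) + n - 2) = v at *
    generalize Real.Gamma ((l : ℝ) + (n : ℝ) / 2) = u at *
    field_simp
    ring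

end

end SOpq

/-! ### The associated functions -/

namespace SOpq
open Finset

noncomputable section

/-- The moments of the basis functions on one of the two spheres. -/
def sphereMoment (n l : ℕ) : ℕ → ℂ :=
  if n = 2 then fun k => ∫ φ in (0 : ℝ)..(2 * Real.pi), ((Real.cos φ : ℝ) : ℂ) ^ k *
      Complex.exp (-Complex.I * l * φ)
  else fun k => ∫ x in (-1 : ℝ)..1, (x : ℂ) ^ k *
      ((gegenbauer l (((n : ℝ) - 2) / 2) x : ℂ) * (weight n x : ℂ))

lemma hasMoments_sphere {n : ℕ} (hn : 2 ≤ n) (l : ℕ) :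
    HasMoments (sphereMoment n l) (sphereConst n l) ((l : ℂ) + (n : ℂ) / 2) l := by
  rcases hn.eq_or_lt with rfl | hn
  · have h := hasMoments_circle l
    simp only [sphereMoment, sphereConst, if_true]
    push_cast at h ⊢
    exact h
  · rw [sphereMoment, sphereConst, if_neg (by omega), if_neg (by omega)]
    exact hasMoments_gegenbauer hn l

lemma Lam_comm (α x y : ℝ) : Lam α x y = Lam α y x := by
  rw [Lam, Lam]; ring

lemma LamPow_comm (σ : ℂ) (α x y : ℝ) : LamPow σ α x y = LamPow σ α y x := by
  rw [LamPow, LamPow, Lam_comm]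

lemma continuous_weight {n : ℕ} (hn : 3 ≤ n) : Continuous (weight n) := by
  have hn' : (3 : ℝ) ≤ n := by exact_mod_cast hn
  exact continuous_one_sub_sq_rpow (by linarith)

lemma continuous_gegenbauer_mul_weight {n : ℕ} (hn : 3 ≤ n) (l : ℕ) :
    Continuous fun x => (gegenbauer l (((n : ℝ) - 2) / 2) x : ℂ) * (weight n x : ℂ) := by
  have h1 := continuous_weight hn
  have h2 := continuous_gegenbauer l (((n : ℝ) - 2) / 2)
  fun_prop

lemma sq_le_one_of_mem_uIcc {x : ℝ} (hx : x ∈ Set.uIcc (-1 : ℝ) 1) : x ^ 2 ≤ 1 := by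
  rw [Set.uIcc_of_le (by norm_num)] at hx
  nlinarith [hx.1, hx.2]

lemma sphereNorm_two (l : ℕ) : sphereNorm 2 l = 1 / (2 * Real.pi) := by
  simp [sphereNorm]

/-- The associated functions in terms of moments. -/
lemma exists_hasSum_assocP {p q : ℕ} (hp : 2 ≤ p) (hq : 2 ≤ q) (σ : ℂ) (lam mu : ℕ) (α : ℝ) :
    ∃ T, HasSum (fun n => momentCoeff (-σ / 2) (sphereMoment p mu) (sphereMoment q lam) n *
        (Real.tanh α : ℂ) ^ n) T ∧
      (Real.cosh α : ℂ) * assocP p q σ lam mu α =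
        (sphereNorm p mu : ℂ) * (sphereNorm q lam : ℂ) * T := by
  have hcos : Continuous Real.cos := Real.continuous_cos
  have hexp : ∀ l : ℕ, Continuous fun φ : ℝ => Complex.exp (-Complex.I * l * φ) := fun l => by
    fun_prop
  have hcos1 : ∀ φ ∈ Set.uIcc 0 (2 * Real.pi), Real.cos φ ^ 2 ≤ 1 := fun φ _ =>
    Real.cos_sq_le_one φ
  have hid : ∀ x ∈ Set.uIcc (-1 : ℝ) 1, (id x) ^ 2 ≤ 1 := fun x hx => sq_le_one_of_mem_uIcc hx
  rcases hp.eq_or_lt with rfl | hp <;> rcases hq.eq_or_lt with rfl | hq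
  · refine ⟨_, hasSum_integral_integral_LamPow hcos (hexp mu) hcos1 hcos (hexp lam) hcos1 σ α, ?_⟩
    rw [assocP, if_neg (by omega), if_neg (by omega), if_neg (by omega), mul_left_comm]
    congr 1
    · simp [sphereNorm]; ring
    · congr 3
      funext χ
      congr 1
      funext φ
      rw [← Complex.exp_add]
      congr 2
      ring
  -- The outer variable here is y, so it takes the first slot; the symmetry of Λ and of
  -- `momentCoeff` restores the order of p and q.
  · have h := hasSum_integral_integral_LamPow continuous_id
      (continuous_gegenbauer_mul_weight hq lam) hid hcos (hexp mu) hcos1 σ α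
    refine ⟨_, by
      simp only [momentCoeff_symm _ (sphereMoment 2 mu)]
      rw [sphereMoment, sphereMoment, if_pos rfl, if_neg (by omega)]
      exact h, ?_⟩
    rw [assocP, if_neg (by omega), if_neg (by omega), if_pos (by omega), mul_left_comm,
      aOne_eq hq]
    congr 1
    · rw [sphereNorm_two, Complex.ofReal_mul, mul_comm]
    · congr 3
      funext y
      congr 1
      funext χ
      rw [LamPow_comm, id]
      ring
  · have h := hasSum_integral_integral_LamPow continuous_id
      (continuous_gegenbauer_mul_weight hp mu) hid hcos (hexp lam) hcos1 σ α
    refine ⟨_, by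
      rw [sphereMoment, sphereMoment, if_pos rfl, if_neg (by omega)]
      exact h, ?_⟩
    rw [assocP, if_neg (by omega), if_pos (by omega), mul_left_comm, aOne_eq hp]
    congr 1
    · rw [sphereNorm_two, Complex.ofReal_mul]
    · congr 3
      funext y
      congr 1
      funext χ
      rw [id]
      ring
  · have h := hasSum_integral_integral_LamPow continuous_id
      (continuous_gegenbauer_mul_weight hq lam) hid continuous_id
      (continuous_gegenbauer_mul_weight hp mu) hid σ α
    refine ⟨_, by
      simp only [momentCoeff_symm _ (sphereMoment p mu)]
      rw [sphereMoment, sphereMoment, if_neg (by omega), if_neg (by omega)]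
      exact h, ?_⟩
    rw [assocP, if_pos (by omega), mul_left_comm, aTwo_eq hp hq]
    congr 1
    · push_cast; rfl
    · congr 3
      funext y
      congr 1
      funext x
      rw [LamPow_comm, id, id]
      ring

/-- Both sides are sums of the same power series in tanh α, as the coefficients are symmetric in the
moment sequences; no interchange of integrals is involved. -/
lemma assocFn_symm {p q : ℕ} (hp : 2 ≤ p) (hq : 2 ≤ q) (ν : ℕ) (σ : ℂ) (r s : ℕ) (α : ℝ) :
    assocFn p q ν σ r s α = assocFn q p ν σ s r α := by
  obtain ⟨T, h1, h2⟩ := exists_hasSum_assocP hp hq σ (ν + 2 * r) (ν + 2 * s) α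
  obtain ⟨T', h1', h2'⟩ := exists_hasSum_assocP hq hp σ (ν + 2 * s) (ν + 2 * r) α
  simp only [momentCoeff_symm _ (sphereMoment q _)] at h1'
  have hc : (Real.cosh α : ℂ) ≠ 0 := by exact_mod_cast (Real.cosh_pos α).ne'
  rw [assocFn, assocFn]
  apply mul_left_cancel₀ hc
  rw [h2, h2', h1.unique h1']
  ring

/-- The explicit formula, with the normalization factors not yet evaluated. -/
lemma cosh_mul_assocFn {p q ν r s : ℕ} (hp : 2 ≤ p) (hq : 2 ≤ q) (hν : ν ≤ 1) (hrs : r ≤ s)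
    (σ : ℂ) (α : ℝ) :
    (Real.cosh α : ℂ) * assocFn p q ν σ r s α =
      ((2 * s + ν).factorial : ℂ) * poch ((2 - σ - q) / 2) (s - r) /
      (((s - r).factorial : ℂ) * poch (2 * (r : ℂ) + ν + (q : ℂ) / 2) (s - r)) *
      poch (-σ / 2) (s + r + ν) *
      (((sphereNorm p (ν + 2 * s) * sphereConst p (ν + 2 * s)) *
        (sphereNorm q (ν + 2 * r) * sphereConst q (ν + 2 * r) * 2 ^ (ν + 2 * r)) : ℝ) : ℂ) *
      (Real.tanh α : ℂ) ^ (2 * s + ν) *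
      hornSeries u5 (assocNum p q ν σ r s) v3 (assocDen p q ν r s) (tanhSq α) := by
  obtain ⟨T, h1, h2⟩ := exists_hasSum_assocP hp hq σ (ν + 2 * r) (ν + 2 * s) α
  rw [assocFn, h2, eq_hornSeries_of_hasSum hp (by omega) hν hrs (hasMoments_sphere hp _)
    (hasMoments_sphere hq _) σ α h1]
  push_cast
  ring

lemma sphere_factors_eq {p q : ℕ} (hp : 2 ≤ p) (hq : 2 ≤ q) (ν r s : ℕ) :
    (sphereNorm p (ν + 2 * s) * sphereConst p (ν + 2 * s)) *
        (sphereNorm q (ν + 2 * r) * sphereConst q (ν + 2 * r) * 2 ^ (ν + 2 * r)) =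
      (2 : ℝ) ^ (3 - ((p : ℝ) + q) / 2 - ν) /
        (Real.Gamma (2 * (s : ℝ) + ν + (p : ℝ) / 2) *
          Real.Gamma (2 * (r : ℝ) + ν + (q : ℝ) / 2)) *
      √(Real.pi * Real.Gamma ((p : ℝ) / 2) * Real.Gamma ((q : ℝ) / 2) /
        (Real.Gamma (((p : ℝ) - 1) / 2) * Real.Gamma (((q : ℝ) - 1) / 2))) *
      √(Real.Gamma (2 * (s : ℝ) + ν + p - 1) * Real.Gamma (2 * (r : ℝ) + ν + q - 1) /
        (((2 * s + ν).factorial : ℝ) * ((2 * r + ν).factorial : ℝ))) * A2 p q ν r s / 4 ^ s := by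
  have hp' : (2 : ℝ) ≤ p := by exact_mod_cast hp
  have hq' : (2 : ℝ) ≤ q := by exact_mod_cast hq
  have h1 := sphereNorm_mul_sphereConst hp (ν + 2 * s)
  have h2 := sphereNorm_mul_sphereConst hq (ν + 2 * r)
  have hw : (2 : ℝ) ^ (ν + 2 * s) = 2 ^ ν * 4 ^ s := by rw [pow_add, pow_mul]; norm_num
  have h4 : (2 : ℝ) ^ ν * 4 ^ s ≠ 0 := by positivity
  rw [hw] at h1
  -- The power 2^(ν+2s) is absent on the side of p; dividing by it supplies the 2^(-ν) of A₁ and the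
  -- 4^s of the prefactor.
  rw [eq_div_of_mul_eq h4 h1, h2]
  have e1 : ((ν + 2 * s : ℕ) : ℝ) = 2 * (s : ℝ) + ν := by push_cast; ring
  have e2 : ((ν + 2 * r : ℕ) : ℝ) = 2 * (r : ℝ) + ν := by push_cast; ring
  rw [e1, e2, add_comm ν (2 * s), add_comm ν (2 * r), A2]
  have hs : (0 : ℝ) ≤ 2 * (s : ℝ) + ν := by positivity
  have hr : (0 : ℝ) ≤ 2 * (r : ℝ) + ν := by positivity
  have g1 := Real.Gamma_pos_of_pos (s := (p : ℝ) / 2) (by linarith)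
  have g2 := Real.Gamma_pos_of_pos (s := (q : ℝ) / 2) (by linarith)
  have g3 := Real.Gamma_pos_of_pos (s := ((p : ℝ) - 1) / 2) (by linarith)
  have g4 := Real.Gamma_pos_of_pos (s := ((q : ℝ) - 1) / 2) (by linarith)
  have g5 := Real.Gamma_pos_of_pos (s := 2 * (s : ℝ) + ν + p - 1) (by linarith)
  have g6 := Real.Gamma_pos_of_pos (s := 2 * (r : ℝ) + ν + q - 1) (by linarith)
  have g7 : 0 ≤ normRatio p (2 * s + ν) := by
    rw [normRatio]
    split_ifs
    · norm_num
    · push_cast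
      exact div_nonneg (by linarith) (by linarith)
  have he : √Real.pi * √Real.pi = Real.pi := Real.mul_self_sqrt Real.pi_pos.le
  have t1 : √(Real.pi * Real.Gamma ((p : ℝ) / 2) * Real.Gamma ((q : ℝ) / 2) /
        (Real.Gamma (((p : ℝ) - 1) / 2) * Real.Gamma (((q : ℝ) - 1) / 2))) =
      √(√Real.pi * Real.Gamma ((p : ℝ) / 2) / Real.Gamma (((p : ℝ) - 1) / 2)) *
      √(√Real.pi * Real.Gamma ((q : ℝ) / 2) / Real.Gamma (((q : ℝ) - 1) / 2)) := by
    rw [← Real.sqrt_mul (by positivity), div_mul_div_comm]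
    congr 2
    linear_combination (-(Real.Gamma ((p : ℝ) / 2) * Real.Gamma ((q : ℝ) / 2))) * he
  have t2 : √(Real.Gamma (2 * (s : ℝ) + ν + p - 1) * Real.Gamma (2 * (r : ℝ) + ν + q - 1) /
        (((2 * s + ν).factorial : ℝ) * ((2 * r + ν).factorial : ℝ))) =
      √(Real.Gamma (2 * (s : ℝ) + ν + p - 1) / ((2 * s + ν).factorial : ℝ)) *
      √(Real.Gamma (2 * (r : ℝ) + ν + q - 1) / ((2 * r + ν).factorial : ℝ)) := by
    rw [← Real.sqrt_mul (by positivity), div_mul_div_comm]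
  have t3 : (2 : ℝ) ^ (3 - ((p : ℝ) + q) / 2 - ν) =
      2 ^ ((3 - (p : ℝ)) / 2) * 2 ^ ((3 - (q : ℝ)) / 2) / 2 ^ ν := by
    rw [Real.rpow_sub (by norm_num), Real.rpow_natCast, ← Real.rpow_add (by norm_num)]
    congr 2
    ring
  rw [t1, t2, t3, Real.sqrt_mul g7]
  ring

lemma assocFn_eq {p q ν r s : ℕ} (hp : 2 ≤ p) (hq : 2 ≤ q) (hν : ν ≤ 1) (hrs : r ≤ s)
    (σ : ℂ) (α : ℝ) :
    assocFn p q ν σ r s α =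
      prefactor p q ν σ r s * ((Real.tanh α ^ (2 * s + ν) / Real.cosh α : ℝ) : ℂ) *
        hornSeries u5 (assocNum p q ν σ r s) v3 (assocDen p q ν r s) (tanhSq α) := by
  have hc : (Real.cosh α : ℂ) ≠ 0 := by exact_mod_cast (Real.cosh_pos α).ne'
  have h := cosh_mul_assocFn hp hq hν hrs σ α
  rw [sphere_factors_eq hp hq] at h
  apply mul_left_cancel₀ hc
  rw [h, prefactor, A1, Complex.ofReal_div (Real.tanh α ^ (2 * s + ν)), Complex.ofReal_pow]
  generalize hornSeries u5 (assocNum p q ν σ r s) v3 (assocDen p q ν r s) (tanhSq α) = F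
  rw [Complex.ofReal_div, Complex.ofReal_mul _ (A2 p q ν r s)]
  generalize (((2 : ℝ) ^ (3 - ((p : ℝ) + q) / 2 - ν) /
        (Real.Gamma (2 * (s : ℝ) + ν + (p : ℝ) / 2) *
          Real.Gamma (2 * (r : ℝ) + ν + (q : ℝ) / 2)) *
      √(Real.pi * Real.Gamma ((p : ℝ) / 2) * Real.Gamma ((q : ℝ) / 2) /
        (Real.Gamma (((p : ℝ) - 1) / 2) * Real.Gamma (((q : ℝ) - 1) / 2))) *
      √(Real.Gamma (2 * (s : ℝ) + ν + p - 1) * Real.Gamma (2 * (r : ℝ) + ν + q - 1) /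
        (((2 * s + ν).factorial : ℝ) * ((2 * r + ν).factorial : ℝ))) : ℝ) : ℂ) = Z
  rw [show ((4 ^ s : ℝ) : ℂ) = 4 ^ s by push_cast; rfl]
  have e : (Real.cosh α : ℂ) * ((Real.tanh α : ℂ) ^ (2 * s + ν) / (Real.cosh α : ℂ)) =
      (Real.tanh α : ℂ) ^ (2 * s + ν) := by field_simp
  generalize (Real.tanh α : ℂ) ^ (2 * s + ν) / (Real.cosh α : ℂ) = D at e ⊢
  rw [← e]
  ring

/-! ### Zonal functions -/

lemma zonal_eq_assocFn {p q : ℕ} (hq : 2 ≤ q) (σ : ℂ) (α : ℝ) :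
    zonal p q σ α = assocFn p q 0 σ 0 0 α := by
  have hpi : Real.pi ^ ((3 : ℝ) / 2) = √Real.pi * Real.pi := by
    rw [pi_rpow_three_half, pow_succ, Real.sq_sqrt Real.pi_pos.le, mul_comm]
  have he : √Real.pi * √Real.pi = Real.pi := Real.mul_self_sqrt Real.pi_pos.le
  rw [zonal, assocFn, assocP, if_neg (by omega)]
  simp only [mul_zero, add_zero, gegenbauer_zero, Nat.cast_zero, zero_mul, Complex.exp_zero,
    Complex.ofReal_one, mul_one]
  split_ifs with h1 h2 h3
  · rw [aTwo_eq h1.1 h1.2, sphereNorm_zero h1.1, sphereNorm_zero h1.2, div_mul_div_comm,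
      mul_mul_mul_comm (√Real.pi), he, ← mul_assoc Real.pi]
  · rw [aOne_eq h2, sphereNorm_zero h2, hpi, div_mul_div_comm, mul_one,
      show 2 * (√Real.pi * Real.pi) * Real.Gamma (((p : ℝ) - 1) / 2) =
        √Real.pi * Real.Gamma (((p : ℝ) - 1) / 2) * (2 * Real.pi) by ring]
  · rw [aOne_eq h3, sphereNorm_zero h3, hpi, div_mul_div_comm, mul_one,
      show 2 * (√Real.pi * Real.pi) * Real.Gamma (((q : ℝ) - 1) / 2) =
        √Real.pi * Real.Gamma (((q : ℝ) - 1) / 2) * (2 * Real.pi) by ring]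
  · rfl

lemma assocNum_zero (p q : ℕ) (σ : ℂ) : assocNum p q 0 σ 0 0 =
    ![1, 1 / 2, -σ / 2, ((q : ℂ) + σ) / 2, ((p : ℂ) + σ) / 2] := by
  simp [assocNum]; ring

lemma assocDen_zero (p q : ℕ) : assocDen p q 0 0 0 = ![(p : ℂ) / 2, (q : ℂ) / 2, 1] := by
  simp [assocDen]

/-- At a pole of one sphere Λ is the square of a positive number, so the case q = 1 also falls under
the expansion of Λ^(σ/2). -/
lemma cpow_eq_LamPow (σ : ℂ) (α : ℝ) {x : ℝ} (hx : x ^ 2 ≤ 1) :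
    ((Real.cosh α - x * Real.sinh α : ℝ) : ℂ) ^ σ = LamPow σ α 1 x := by
  have hc := Real.cosh_sq α
  have hpos : 0 < Real.cosh α - x * Real.sinh α := by
    have : (x * Real.sinh α) ^ 2 < Real.cosh α ^ 2 := by
      rw [mul_pow]; nlinarith [sq_nonneg (Real.sinh α)]
    linarith [lt_of_pow_lt_pow_left₀ 2 (Real.cosh_pos α).le this]
  have hL : Lam α 1 x = (Real.cosh α - x * Real.sinh α) * (Real.cosh α - x * Real.sinh α) := by
    rw [Lam]; linear_combination (-1) * hc
  rw [LamPow, hL, Complex.ofReal_mul, Complex.mul_cpow_ofReal_nonneg hpos.le hpos.le,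
    ← Complex.cpow_add _ _ (by exact_mod_cast hpos.ne'), add_halves]

lemma exists_hasSum_zonal_one {p : ℕ} (hp : 2 ≤ p) (σ : ℂ) (α : ℝ) :
    ∃ T, HasSum (fun n => momentCoeff (-σ / 2) (fun k => ((1 : ℝ) : ℂ) ^ k) (sphereMoment p 0) n *
        (Real.tanh α : ℂ) ^ n) T ∧
      (Real.cosh α : ℂ) * zonal p 1 σ α = (sphereNorm p 0 : ℂ) * T := by
  rcases hp.eq_or_lt with rfl | hp
  · refine ⟨_, (hasSum_integral_LamPow Real.continuous_cos (c := 0) (d := 2 * Real.pi)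
      (V := fun φ : ℝ => Complex.exp (-Complex.I * (0 : ℕ) * φ)) (by fun_prop)
      (fun φ _ => Real.cos_sq_le_one φ) σ α).1 1 (by norm_num), ?_⟩
    rw [zonal, if_pos rfl, if_neg (by omega), mul_left_comm]
    congr 1
    · simp [sphereNorm]
    · congr 2
      funext χ
      rw [cpow_eq_LamPow σ α (Real.cos_sq_le_one χ)]
      simp
  · have h := (hasSum_integral_LamPow continuous_id (c := -1) (d := 1)
      (continuous_gegenbauer_mul_weight hp 0)
      (fun x hx => sq_le_one_of_mem_uIcc hx) σ α).1 1 (by norm_num)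
    refine ⟨_, by
      rw [sphereMoment, if_neg (by omega)]
      exact h, ?_⟩
    rw [zonal, if_pos rfl, if_pos (by omega), mul_left_comm, sphereNorm_zero hp]
    congr 2
    refine intervalIntegral.integral_congr fun x hx => ?_
    simp only [cpow_eq_LamPow σ α (sq_le_one_of_mem_uIcc hx), id, gegenbauer_zero]
    simp

lemma cosh_mul_zonal {p q : ℕ} (hp : 2 ≤ p) (hq : 1 ≤ q) (σ : ℂ) (α : ℝ) :
    (Real.cosh α : ℂ) * zonal p q σ α =
      hornSeries u5 (assocNum p q 0 σ 0 0) v3 (assocDen p q 0 0 0) (tanhSq α) := by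
  have np : (sphereNorm p 0 : ℂ) * (sphereConst p 0 : ℂ) = 1 := by
    exact_mod_cast sphereNorm_mul_sphereConst_zero hp
  rcases hq.eq_or_lt with rfl | hq
  · obtain ⟨T, h1, h2⟩ := exists_hasSum_zonal_one hp σ α
    have hm := hasMoments_sphere hp 0
    -- The point 1 alone has all moments 1. Since the odd moments of the other sphere vanish, it may
    -- be replaced by the uniform measure on {±1}, which has the standard form of moments.
    have e : (fun n => momentCoeff (-σ / 2) (fun k => ((1 : ℝ) : ℂ) ^ k) (sphereMoment p 0) n *
        (Real.tanh α : ℂ) ^ n) = fun n => momentCoeff (-σ / 2) (sphereMoment p 0)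
          (fun k => if Even k then 1 else 0) n * (Real.tanh α : ℂ) ^ n := by
      funext n
      simp only [Complex.ofReal_one, one_pow]
      rw [momentCoeff_even_part _ _ hm, momentCoeff_symm]
    rw [e] at h1
    rw [h2, eq_hornSeries_of_hasSum (ν := 0) (r := 0) (s := 0) hp le_rfl (by norm_num) le_rfl hm
      hasMoments_point σ α h1]
    simp
    rw [← mul_assoc, np, one_mul]
  · have nq := sphereNorm_mul_sphereConst_zero (n := q) hq
    rw [zonal_eq_assocFn hq, cosh_mul_assocFn hp hq (by norm_num) le_rfl]
    simp [nq, np]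

end

end SOpq
theorem mainTheorem2 :
    -- the explicit formula for `s ≥ r`, with absolute convergence of the double series
    (∀ (p q ν r s : ℕ) (σ : ℂ) (α : ℝ), 2 ≤ p → 2 ≤ q → ν ≤ 1 → r ≤ s →
      Summable (hornTerm u5 (assocNum p q ν σ r s) v3 (assocDen p q ν r s) (tanhSq α)) ∧
      assocFn p q ν σ r s α =
        prefactor p q ν σ r s * ((Real.tanh α ^ (2 * s + ν) / Real.cosh α : ℝ) : ℂ) *
          hornSeries u5 (assocNum p q ν σ r s) v3 (assocDen p q ν r s) (tanhSq α)) ∧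
    -- the symmetry
    (∀ (p q ν r s : ℕ) (σ : ℂ) (α : ℝ), 2 ≤ p → 2 ≤ q → ν ≤ 1 →
      assocFn p q ν σ r s α = assocFn q p ν σ s r α) ∧
    -- the explicit formula for `s ≤ r`
    (∀ (p q ν r s : ℕ) (σ : ℂ) (α : ℝ), 2 ≤ p → 2 ≤ q → ν ≤ 1 → s ≤ r →
      Summable (hornTerm u5 (assocNum q p ν σ s r) v3 (assocDen q p ν s r) (tanhSq α)) ∧
      assocFn p q ν σ r s α =
        prefactor q p ν σ s r * ((Real.tanh α ^ (2 * r + ν) / Real.cosh α : ℝ) : ℂ) *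
          hornSeries u5 (assocNum q p ν σ s r) v3 (assocDen q p ν s r) (tanhSq α)) ∧
    -- the zonal function is the case `r = s = ν = 0`
    (∀ (p q : ℕ) (σ : ℂ) (α : ℝ), 2 ≤ p → 2 ≤ q →
      zonal p q σ α = assocFn p q 0 σ 0 0 α) ∧
    -- the zonal formula
    (∀ (p q : ℕ) (σ : ℂ) (α : ℝ), 2 ≤ p → 1 ≤ q →
      Summable (hornTerm u5
        ![1, 1 / 2, -σ / 2, ((q : ℂ) + σ) / 2, ((p : ℂ) + σ) / 2]
        v3 ![(p : ℂ) / 2, (q : ℂ) / 2, 1] (tanhSq α)) ∧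
      zonal p q σ α = ((1 / Real.cosh α : ℝ) : ℂ) *
        hornSeries u5
          ![1, 1 / 2, -σ / 2, ((q : ℂ) + σ) / 2, ((p : ℂ) + σ) / 2]
          v3 ![(p : ℂ) / 2, (q : ℂ) / 2, 1] (tanhSq α)) := by
  refine ⟨fun p q ν r s σ α hp hq hν hrs => ⟨summable_hornTerm hp (by omega) ν σ hrs α,
      assocFn_eq hp hq hν hrs σ α⟩, fun p q ν r s σ α hp hq _ => assocFn_symm hp hq ν σ r s α,
    fun p q ν r s σ α hp hq hν hrs => ⟨summable_hornTerm hq (by omega) ν σ hrs α, ?_⟩,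
    fun p q σ α _ hq => zonal_eq_assocFn hq σ α, fun p q σ α hp hq => ?_⟩
  · rw [assocFn_symm hp hq, assocFn_eq hq hp hν hrs]
  · rw [← assocNum_zero, ← assocDen_zero]
    refine ⟨summable_hornTerm hp hq 0 σ le_rfl α, ?_⟩
    have hc : (Real.cosh α : ℂ) ≠ 0 := by exact_mod_cast (Real.cosh_pos α).ne'
    rw [← cosh_mul_zonal hp hq, Complex.ofReal_div, Complex.ofReal_one]
    field_simp
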